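/- A dyadic interval is $[j2^k,(j+1)2^k)$ with $j,k\in\mathbb Z$, and its $L^\infty$-normalized Haar function is $h_I=-\mathbf 1_{I_{\mathrm{left}}}+\mathbf 1_{I_{\mathrm{right}}}$, where $I_{\mathrm{left}}$ and $I_{\mathrm{right}}$ are the left and right halves of $I$. A dyadic rectangle in $\mathbb R^d$ is a product $R=R_1\times\cdots\times R_d$ of dyadic intervals, and $h_R(x_1,\dots,x_d)=\prod_{j=1}^d h_{R_j}(x_j)$; $|R|$ denotes its volume. Let $d\ge 3$ be an integer and let $\eta$ be a real number with $\eta<\frac{d-1}{2}+\frac{1}{8d}$. Then there is a constant $c=c(d,\eta)>0$ such that for every integer $n\ge 1$ and every choice of coefficients $\alpha(R)\in\{-1,1\}$, indexed by the dyadic rectangles $R\subset[0,1]^d$ with $|R|=2^{-n}$, $$ c\,n^{\eta}\;\le\;\Bigl\|\sum_{R\subset[0,1]^d,\ |R|=2^{-n}}\alpha(R)\,h_R\Bigr\|_{L^\infty([0,1]^d)} . $$ -/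

import Mathlib

open MeasureTheory
open scoped ENNReal

/-- An index `(k, j) : ℤ × ℤ` for the dyadic interval `[j 2^k, (j+1) 2^k)`. -/
structure DyadicInterval where
  scale : ℤ
  pos : ℤ

namespace DyadicInterval

/-- The length `2^k`. -/
noncomputable def length (I : DyadicInterval) : ℝ := (2 : ℝ) ^ I.scale

/-- The left endpoint `j 2^k`. -/
noncomputable def left (I : DyadicInterval) : ℝ := (I.pos : ℝ) * I.length

/-- The dyadic interval `[j 2^k, (j+1) 2^k)` as a set of reals. -/
def toSet (I : DyadicInterval) : Set ℝ := Set.Ico I.left (I.left + I.length)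

/-- The left half of a dyadic interval. -/
def leftHalf (I : DyadicInterval) : Set ℝ := Set.Ico I.left (I.left + I.length / 2)

/-- The right half of a dyadic interval. -/
def rightHalf (I : DyadicInterval) : Set ℝ :=
  Set.Ico (I.left + I.length / 2) (I.left + I.length)

/-- The `L^∞`-normalized Haar function of a dyadic interval: `-1` on the left half, `1` on the
right half, and `0` elsewhere. -/
noncomputable def haar (I : DyadicInterval) (x : ℝ) : ℝ :=
  -I.leftHalf.indicator 1 x + I.rightHalf.indicator 1 x

theorem length_pos (I : DyadicInterval) : 0 < I.length := zpow_pos two_pos _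

/-- The index `(k, j)` of a dyadic interval is determined by the interval as a set. -/
theorem toSet_injective : Function.Injective toSet := by
  intro I J h
  have hI := I.length_pos
  have hJ := J.length_pos
  have h' : Set.Ico I.left (I.left + I.length) = Set.Ico J.left (J.left + J.length) := h
  have h1 : I.left = J.left := by
    have := congrArg sInf h'
    rwa [csInf_Ico (by linarith), csInf_Ico (by linarith)] at this
  have h2 : I.length = J.length := by
    have := congrArg sSup h'
    rw [csSup_Ico (by linarith), csSup_Ico (by linarith)] at this
    linarith
  have h3 : I.scale = J.scale := zpow_right_injective₀ two_pos (by norm_num) h2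
  have h4 : I.pos = J.pos := by
    unfold left at h1
    rw [h2] at h1
    exact_mod_cast mul_right_cancel₀ hJ.ne' h1
  cases I; cases J; simp_all

end DyadicInterval

/-- A dyadic rectangle in `ℝ^d`: a product of `d` dyadic intervals. -/
abbrev DyadicRect (d : ℕ) := Fin d → DyadicInterval

namespace DyadicRect

/-- The dyadic rectangle `R_1 × ⋯ × R_d` as a subset of `ℝ^d`. -/
def toSet {d : ℕ} (R : DyadicRect d) : Set (Fin d → ℝ) :=
  Set.pi Set.univ fun i => (R i).toSet

/-- The Haar function `h_R(x) = ∏ i, h_{R_i}(x_i)` of a dyadic rectangle. -/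
noncomputable def haar {d : ℕ} (R : DyadicRect d) (x : Fin d → ℝ) : ℝ :=
  ∏ i, (R i).haar (x i)

end DyadicRect

/-- The set of dyadic rectangles contained in `[0,1]^d` with volume `2^{-n}`. -/
def hyperbolicRects (d n : ℕ) : Set (DyadicRect d) :=
  {R | R.toSet ⊆ Set.Icc 0 1 ∧ volume R.toSet = (2⁻¹ : ℝ≥0∞) ^ n}

theorem hyperbolicRects_finite (d n : ℕ) : (hyperbolicRects d n).Finite := by
  have hfin : {I : DyadicInterval | I.scale ∈ Set.Icc (-(n : ℤ)) 0 ∧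
      I.pos ∈ Set.Icc (0 : ℤ) (2 ^ n)}.Finite := by
    have hp : ((Set.Icc (-(n : ℤ)) 0) ×ˢ (Set.Icc (0 : ℤ) (2 ^ n))).Finite :=
      (Set.finite_Icc _ _).prod (Set.finite_Icc _ _)
    refine (hp.image fun p => DyadicInterval.mk p.1 p.2).subset ?_
    rintro ⟨k, j⟩ ⟨hk, hj⟩
    exact ⟨(k, j), ⟨hk, hj⟩, rfl⟩
  refine (Set.Finite.pi' fun _ : Fin d => hfin).subset ?_
  rintro R ⟨hsub, hvol⟩ i
  have hside : ∀ i, (R i).toSet ⊆ Set.Icc (0 : ℝ) 1 := by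
    intro i y hy
    have hz : (Function.update (fun l => (R l).left) i y) ∈ DyadicRect.toSet R := by
      intro l _
      by_cases hl : l = i
      · subst hl; simpa using hy
      · simp only [Function.update_of_ne hl]
        exact ⟨le_rfl, by linarith [(R l).length_pos]⟩
    have := hsub hz
    exact ⟨by simpa using this.1 i, by simpa using this.2 i⟩
  have hbd : ∀ i, 0 ≤ (R i).left ∧ (R i).left + (R i).length ≤ 1 := by
    intro i
    have hlt : (R i).left < (R i).left + (R i).length := by linarith [(R i).length_pos]
    have hcl := closure_minimal (hside i) isClosed_Icc
    unfold DyadicInterval.toSet at hcl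
    rw [closure_Ico hlt.ne] at hcl
    exact ⟨(hcl ⟨le_rfl, hlt.le⟩).1, (hcl ⟨hlt.le, le_rfl⟩).2⟩
  have hlen1 : ∀ i, (R i).length ≤ 1 := fun i => by linarith [(hbd i).1, (hbd i).2]
  have hprod : ∏ l, (R l).length = (2⁻¹ : ℝ) ^ n := by
    have h := congrArg ENNReal.toReal hvol
    simpa [DyadicRect.toSet, DyadicInterval.toSet, volume_pi_pi, ENNReal.toReal_prod,
      ENNReal.toReal_ofReal (DyadicInterval.length_pos _).le] using h
  have hge : (2⁻¹ : ℝ) ^ n ≤ (R i).length := by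
    rw [← hprod, ← Finset.mul_prod_erase _ _ (Finset.mem_univ i)]
    exact mul_le_of_le_one_right (R i).length_pos.le
      (Finset.prod_le_one (fun l _ => (R l).length_pos.le) fun l _ => hlen1 l)
  have hpos0 : (0 : ℝ) ≤ ((R i).pos : ℝ) :=
    nonneg_of_mul_nonneg_left (hbd i).1 (R i).length_pos
  have hposn : ((R i).pos : ℝ) ≤ 2 ^ n := by
    have h1 : ((R i).pos : ℝ) * (2⁻¹ : ℝ) ^ n ≤ 1 :=
      (mul_le_mul_of_nonneg_left hge hpos0).trans
        (by have := (hbd i).2; have := (R i).length_pos; unfold DyadicInterval.left at *; linarith)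
    rw [inv_pow, ← div_eq_mul_inv, div_le_one (by positivity)] at h1
    exact h1
  refine ⟨⟨?_, ?_⟩, ⟨by exact_mod_cast hpos0, by exact_mod_cast hposn⟩⟩
  · have : (2 : ℝ) ^ (-(n : ℤ)) ≤ (2 : ℝ) ^ (R i).scale := by
      simpa [DyadicInterval.length] using hge
    exact (zpow_le_zpow_iff_right₀ (by norm_num)).1 this
  · have : (2 : ℝ) ^ (R i).scale ≤ (2 : ℝ) ^ (0 : ℤ) := by
      simpa [DyadicInterval.length] using hlen1 i
    exact (zpow_le_zpow_iff_right₀ (by norm_num)).1 this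

/-- The hyperbolic Haar sum `∑ α(R) h_R` over all dyadic rectangles `R ⊆ [0,1]^d` with
`|R| = 2^{-n}`. -/
noncomputable def hyperbolicHaarSum (d n : ℕ) (α : DyadicRect d → ℝ) (x : Fin d → ℝ) : ℝ :=
  ∑ R ∈ (hyperbolicRects_finite d n).toFinset, α R * R.haar x

/-! Put `e = d - 2`. On a small dyadic cube the sum depends only on binary digits, so it becomes a
function on a finite space of digit strings. Collecting rectangles by side lengths gives signs `F m
ρ`: `m` is the level in the first coordinate, `ρ` gives the levels in the last `e`, and the level in
the second is forced by the volume. Let `N` be the number of admissible `(m, ρ)`, of order `n ^ (d -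
1)`, and let `G m = ∑ ρ, F m ρ`.

The `G m` are martingale differences in the first coordinate, so `∏ exp (r * G m) / cosh (r * G m)`
has mean exactly `1`. If `∑ G m` stayed below `√(p * N) / 12`, then with `r = √(p / N)` the mean of
`∏ 1 / cosh (r * G m)` would be at least `exp (-p / 12)`. This is impossible once the square
function `∑ (G m) ^ 2` is at least `N / 2`, with no single term above `N / p`, outside a set of
proportion `exp (-p / 6)`: the mean is then at most `2 * exp (-p / 6)` (`exists_sqrt_le_sum`).
Taking `p = (n + 1) ^ (1 / (4 * d))` yields the exponent.

The heart is the lower tail of the square function (`IsHaarFamily.exceptProb_sq_sum_ge`). The free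
coordinates are treated one at a time: a vector-valued martingale is rarely much shorter than its
square function (`exceptProb_sq_sum_ge`), shown by merging dyadic blocks of increments and bounding
the inner products of sibling blocks. Those are scalar martingales whose size is governed by the
matrix of increments, measured in the Schatten 4-norm.

That norm is small for two reasons. With the other free levels fixed, different columns are nearly
orthogonal, because their inner products are martingales in the forced coordinate
(`exceptProb_sum_mul_le`). The Schatten 4-norm is moreover 2-uniformly smooth, so summing over the
other free levels costs only a square root per coordinate, up to powers of `p`
(`exceptProb_gram_sum`). -/

/-! ### Exceptional sets and union bounds. -/

/-- `P` holds outside a set of proportion at most `x` in the finite type `Ω`. -/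
def ExceptProb {Ω : Type*} [Fintype Ω] (x : ℝ) (P : Ω → Prop) : Prop :=
  (({ω | ¬ P ω} : Set Ω).ncard : ℝ) ≤ x * Fintype.card Ω

namespace ExceptProb

variable {Ω : Type*} [Fintype Ω] {x y : ℝ} {P Q : Ω → Prop}

theorem mono (h : ExceptProb x P) (hxy : x ≤ y) (hPQ : ∀ ω, P ω → Q ω) : ExceptProb y Q := by
  unfold ExceptProb at *
  have h1 : ({ω | ¬ Q ω} : Set Ω).ncard ≤ ({ω | ¬ P ω} : Set Ω).ncard :=
    Set.ncard_le_ncard (fun _ hω hP => hω (hPQ _ hP)) (Set.toFinite _)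
  have h2 : (({ω | ¬ Q ω} : Set Ω).ncard : ℝ) ≤ ({ω | ¬ P ω} : Set Ω).ncard := by exact_mod_cast h1
  have h3 : x * Fintype.card Ω ≤ y * Fintype.card Ω := by gcongr
  linarith

theorem and (hP : ExceptProb x P) (hQ : ExceptProb y Q) :
    ExceptProb (x + y) (fun ω => P ω ∧ Q ω) := by
  unfold ExceptProb at *
  have h1 : ({ω | ¬ (P ω ∧ Q ω)} : Set Ω) = {ω | ¬ P ω} ∪ {ω | ¬ Q ω} := by
    ext ω; simp only [Set.mem_ofPred_eq, Set.mem_union]; tauto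
  have h2 : (({ω | ¬ (P ω ∧ Q ω)} : Set Ω).ncard : ℝ) ≤
      ({ω | ¬ P ω} : Set Ω).ncard + ({ω | ¬ Q ω} : Set Ω).ncard := by
    rw [h1]; exact_mod_cast Set.ncard_union_le _ _
  linarith

theorem of_forall (hx : 0 ≤ x) (h : ∀ ω, P ω) : ExceptProb x P := by
  unfold ExceptProb
  have : ({ω | ¬ P ω} : Set Ω) = ∅ := by ext ω; simp [h ω]
  rw [this]
  simp only [Set.ncard_empty, Nat.cast_zero]
  positivity

theorem forall_finset {ι : Type*} (s : Finset ι) {P : ι → Ω → Prop}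
    (h : ∀ i ∈ s, ExceptProb x (P i)) : ExceptProb (s.card * x) (fun ω => ∀ i ∈ s, P i ω) := by
  classical
  induction s using Finset.induction_on with
  | empty => exact of_forall (by simp) (by simp)
  | insert a s ha ih =>
    have h1 := (h a (Finset.mem_insert_self a s)).and
      (ih fun i hi => h i (Finset.mem_insert_of_mem hi))
    refine h1.mono (by rw [Finset.card_insert_of_notMem ha]; push_cast; linarith) ?_
    intro ω hω i hi
    rcases Finset.mem_insert.1 hi with rfl | hi
    · exact hω.1
    · exact hω.2 i hi

theorem forall_fintype {ι : Type*} [Fintype ι] {P : ι → Ω → Prop}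
    (h : ∀ i, ExceptProb x (P i)) : ExceptProb (Fintype.card ι * x) (fun ω => ∀ i, P i ω) :=
  (forall_finset Finset.univ fun i _ => h i).mono le_rfl fun _ hω i => hω i (Finset.mem_univ i)

/-- Markov's inequality for exponential moments. -/
theorem of_sum_exp_le {X : Ω → ℝ} (hX : ∑ ω, Real.exp (X ω) ≤ Fintype.card Ω) (p : ℝ) :
    ExceptProb (Real.exp (-p)) (fun ω => X ω ≤ p) := by
  classical
  unfold ExceptProb
  have h1 : (({ω | ¬ X ω ≤ p} : Set Ω).ncard : ℝ) * Real.exp p ≤ ∑ ω, Real.exp (X ω) := by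
    have h2 : ({ω | ¬ X ω ≤ p} : Set Ω) = ↑(Finset.univ.filter fun ω => ¬ X ω ≤ p) := by
      ext; simp
    rw [h2, Set.ncard_coe_finset, ← nsmul_eq_mul, ← Finset.sum_const]
    refine (Finset.sum_le_sum fun ω hω => ?_).trans
      (Finset.sum_le_sum_of_subset_of_nonneg (Finset.filter_subset _ _)
        fun ω _ _ => (Real.exp_pos _).le)
    exact Real.exp_le_exp.2 (not_le.1 (Finset.mem_filter.1 hω).2).le
  rw [Real.exp_neg, inv_mul_eq_div, le_div_iff₀ (Real.exp_pos p)]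
  exact h1.trans hX

end ExceptProb

/-! ### Haar functions as martingale differences. -/

/-- A function that is odd under the `i`-th permutation and invariant under all later ones, like
the product of the `i`-th Rademacher function with a function of the preceding digits. -/
structure IsHaar {Ω ι : Type*} [LT ι] (τ : ι → Equiv.Perm Ω) (i : ι) (g : Ω → ℝ) : Prop where
  odd : ∀ ω, g (τ i ω) = -g ω
  invariant : ∀ l, i < l → ∀ ω, g (τ l ω) = g ω

namespace IsHaar

variable {Ω ι : Type*} [LT ι] {τ : ι → Equiv.Perm Ω} {i : ι}

theorem zero : IsHaar τ i (fun _ => 0) := ⟨fun _ => by simp, fun _ _ _ => rfl⟩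

theorem const_mul {g : Ω → ℝ} (c : ℝ) (h : IsHaar τ i g) : IsHaar τ i (fun ω => c * g ω) :=
  ⟨fun ω => by simp [h.odd], fun l hl ω => by simp [h.invariant l hl]⟩

theorem neg {g : Ω → ℝ} (h : IsHaar τ i g) : IsHaar τ i (fun ω => -g ω) :=
  ⟨fun ω => by simp [h.odd], fun l hl ω => by simp [h.invariant l hl]⟩

theorem sum {κ : Type*} (s : Finset κ) {g : κ → Ω → ℝ} (h : ∀ a ∈ s, IsHaar τ i (g a)) :
    IsHaar τ i (fun ω => ∑ a ∈ s, g a ω) := by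
  refine ⟨fun ω => ?_, fun l hl ω => Finset.sum_congr rfl fun a ha => (h a ha).invariant l hl ω⟩
  rw [← Finset.sum_neg_distrib]
  exact Finset.sum_congr rfl fun a ha => (h a ha).odd ω

theorem mul_invariant {g k : Ω → ℝ} (h : IsHaar τ i g)
    (hk : ∀ ω, k (τ i ω) = k ω) (hk' : ∀ l, i < l → ∀ ω, k (τ l ω) = k ω) :
    IsHaar τ i (fun ω => g ω * k ω) :=
  ⟨fun ω => by simp [h.odd, hk], fun l hl ω => by simp [h.invariant l hl, hk' l hl]⟩

end IsHaar

/-! ### Exponential moments of scalar martingales. -/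

section Martingale

variable {Ω ι : Type*} [Fintype Ω] [LinearOrder ι] {τ : ι → Equiv.Perm Ω} {D : ι → Ω → ℝ}

/-- Peel off the largest index `a`. The other factors and `D a ω ^ 2` are invariant under `τ a`, so
averaging over the flip turns `exp (D a ω)` into `cosh (D a ω)`, which is at most `exp (D a ω ^ 2 /
2)`. -/
theorem sum_exp_martingale_le (hD : ∀ i, IsHaar τ i (D i)) (s : Finset ι) :
    ∑ ω, Real.exp (∑ i ∈ s, (D i ω - D i ω ^ 2 / 2)) ≤ Fintype.card Ω := by
  induction s using Finset.induction_on_max with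
  | empty => simp
  | insert a s ha ih =>
    have hna : a ∉ s := fun h => lt_irrefl _ (ha a h)
    refine le_trans ?_ ih
    set W : Ω → ℝ := fun ω => Real.exp (∑ i ∈ s, (D i ω - D i ω ^ 2 / 2)) with hW
    have hWinv : ∀ ω, W (τ a ω) = W ω := fun ω => by
      simp only [hW]
      congr 1
      exact Finset.sum_congr rfl fun i hi => by rw [(hD i).invariant a (ha i hi)]
    have h1 : ∀ ω, Real.exp (∑ i ∈ insert a s, (D i ω - D i ω ^ 2 / 2)) =
        W ω * Real.exp (-(D a ω ^ 2 / 2)) * Real.exp (D a ω) := fun ω => by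
      rw [Finset.sum_insert hna, mul_assoc, ← Real.exp_add, hW, ← Real.exp_add]
      ring_nf
    have h2 : ∑ ω, W ω * Real.exp (-(D a ω ^ 2 / 2)) * Real.exp (D a ω) =
        ∑ ω, W ω * Real.exp (-(D a ω ^ 2 / 2)) * Real.exp (-D a ω) := by
      rw [← Equiv.sum_comp (τ a)]
      refine Finset.sum_congr rfl fun ω _ => ?_
      rw [hWinv, (hD a).odd, neg_sq]
    have h3 : ∑ ω, W ω * Real.exp (-(D a ω ^ 2 / 2)) * Real.exp (D a ω) =
        ∑ ω, W ω * (Real.exp (-(D a ω ^ 2 / 2)) * Real.cosh (D a ω)) := by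
      have h4 : ∀ ω, W ω * (Real.exp (-(D a ω ^ 2 / 2)) * Real.cosh (D a ω)) =
          (W ω * Real.exp (-(D a ω ^ 2 / 2)) * Real.exp (D a ω) +
            W ω * Real.exp (-(D a ω ^ 2 / 2)) * Real.exp (-D a ω)) / 2 := fun ω => by
        rw [Real.cosh_eq]; ring
      simp_rw [h4]
      rw [← Finset.sum_div, Finset.sum_add_distrib, ← h2]
      ring
    simp_rw [h1]
    rw [h3]
    refine Finset.sum_le_sum fun ω _ => ?_
    have h5 : Real.exp (-(D a ω ^ 2 / 2)) * Real.cosh (D a ω) ≤ 1 := by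
      rw [Real.exp_neg, inv_mul_le_iff₀ (Real.exp_pos _), mul_one]
      exact Real.cosh_le_exp_half_sq _
    exact mul_le_of_le_one_right (Real.exp_pos _).le h5

/-- The same symmetrization, normalized by `cosh` so that nothing is lost. An identity is needed
because it is used to bound the mean from below. -/
theorem sum_exp_div_cosh_eq (hD : ∀ i, IsHaar τ i (D i)) (s : Finset ι) :
    ∑ ω, ∏ i ∈ s, (Real.exp (D i ω) / Real.cosh (D i ω)) = Fintype.card Ω := by
  induction s using Finset.induction_on_max with
  | empty => simp
  | insert a s ha ih =>
    have hna : a ∉ s := fun h => lt_irrefl _ (ha a h)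
    rw [← ih]
    set W : Ω → ℝ := fun ω => ∏ i ∈ s, (Real.exp (D i ω) / Real.cosh (D i ω)) with hW
    have hWinv : ∀ ω, W (τ a ω) = W ω := fun ω =>
      Finset.prod_congr rfl fun i hi => by rw [(hD i).invariant a (ha i hi)]
    have h1 : ∀ ω, ∏ i ∈ insert a s, (Real.exp (D i ω) / Real.cosh (D i ω)) =
        Real.exp (D a ω) / Real.cosh (D a ω) * W ω := fun ω => Finset.prod_insert hna
    simp_rw [h1]
    have h2 : ∑ ω, Real.exp (D a ω) / Real.cosh (D a ω) * W ω =
        ∑ ω, Real.exp (-D a ω) / Real.cosh (D a ω) * W ω := by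
      rw [← Equiv.sum_comp (τ a)]
      refine Finset.sum_congr rfl fun ω _ => ?_
      rw [hWinv, (hD a).odd, Real.cosh_neg]
    have h3 : ∑ ω, Real.exp (D a ω) / Real.cosh (D a ω) * W ω +
        ∑ ω, Real.exp (-D a ω) / Real.cosh (D a ω) * W ω = 2 * ∑ ω, W ω := by
      rw [← Finset.sum_add_distrib, Finset.mul_sum]
      refine Finset.sum_congr rfl fun ω _ => ?_
      have := (Real.cosh_pos (D a ω)).ne'
      rw [← add_mul, ← add_div]
      congr 1
      rw [div_eq_iff this, Real.cosh_eq]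
      ring
    linarith

/-- Markov's inequality for the martingale scaled by `c`. The random square function is kept in the
bound, so that it can be estimated later on an event that is not measurable with respect to the
past. -/
theorem exceptProb_martingale_le (hD : ∀ i, IsHaar τ i (D i)) (s : Finset ι) {c : ℝ} (hc : 0 < c)
    (p : ℝ) : ExceptProb (Real.exp (-p))
      (fun ω => ∑ i ∈ s, D i ω ≤ c / 2 * ∑ i ∈ s, D i ω ^ 2 + p / c) := by
  refine (ExceptProb.of_sum_exp_le
    (sum_exp_martingale_le (fun i => (hD i).const_mul c) s) p).mono le_rfl fun ω hω => ?_
  have h : ∑ i ∈ s, (c * D i ω - (c * D i ω) ^ 2 / 2) =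
      c * (∑ i ∈ s, D i ω - c / 2 * ∑ i ∈ s, D i ω ^ 2) := by
    rw [Finset.mul_sum, ← Finset.sum_sub_distrib, Finset.mul_sum]
    exact Finset.sum_congr rfl fun i _ => by ring
  rw [h, ← le_div_iff₀' hc] at hω
  linarith

end Martingale

/-! ### The Schatten 4-norm. -/

section Gram

variable {A B : Type*} [Fintype A]

/-- The matrix `Xᵀ Y`, as a vector of the Euclidean (Hilbert–Schmidt) space. -/
noncomputable def gramVec (X Y : A → B → ℝ) : EuclideanSpace ℝ (B × B) :=
  WithLp.toLp 2 fun q => ∑ a, X a q.1 * Y a q.2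

theorem gramVec_add (X X' Y : A → B → ℝ) :
    gramVec (X + X') Y = gramVec X Y + gramVec X' Y := by
  ext q
  simp [gramVec, add_mul, Finset.sum_add_distrib]

theorem gramVec_add_right (X Y Y' : A → B → ℝ) :
    gramVec X (Y + Y') = gramVec X Y + gramVec X Y' := by
  ext q
  simp [gramVec, mul_add, Finset.sum_add_distrib]

theorem gramVec_neg (X Y : A → B → ℝ) : gramVec (-X) Y = -gramVec X Y := by
  ext q
  simp [gramVec]

theorem gramVec_neg_right (X Y : A → B → ℝ) : gramVec X (-Y) = -gramVec X Y := by
  ext q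
  simp [gramVec]

variable [Fintype B]

/-- The Hilbert–Schmidt norm of `Xᵀ X`, that is, the square of the Schatten `4`-norm of `X`. -/
noncomputable def gram (X : A → B → ℝ) : ℝ := ‖gramVec X X‖

theorem gram_nonneg (X : A → B → ℝ) : 0 ≤ gram X := norm_nonneg _

theorem norm_gramVec_sq (X Y : A → B → ℝ) :
    ‖gramVec X Y‖ ^ 2 = ∑ b, ∑ b', (∑ a, X a b * Y a b') ^ 2 := by
  rw [EuclideanSpace.real_norm_sq_eq, Fintype.sum_prod_type]
  rfl

theorem gram_sq (X : A → B → ℝ) : gram X ^ 2 = ∑ b, ∑ b', (∑ a, X a b * X a b') ^ 2 :=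
  norm_gramVec_sq X X

/-- Cyclicity of the trace: `‖Xᵀ Y‖² = ⟨X Xᵀ, Y Yᵀ⟩`. Cauchy–Schwarz then controls mixed products by
`gram`. -/
theorem norm_gramVec_sq_eq_inner (X Y : A → B → ℝ) :
    ‖gramVec X Y‖ ^ 2 = inner ℝ (gramVec (fun b a => X a b) (fun b a => X a b))
      (gramVec (fun b a => Y a b) (fun b a => Y a b)) := by
  rw [norm_gramVec_sq, PiLp.inner_apply, Fintype.sum_prod_type]
  simp only [gramVec, RCLike.inner_apply, conj_trivial, pow_two, Finset.sum_mul_sum]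
  calc ∑ b, ∑ b', ∑ a, ∑ a', X a b * Y a b' * (X a' b * Y a' b')
      = ∑ b, ∑ a, ∑ b', ∑ a', X a b * Y a b' * (X a' b * Y a' b') :=
        Finset.sum_congr rfl fun b _ => Finset.sum_comm
    _ = ∑ a, ∑ b, ∑ b', ∑ a', X a b * Y a b' * (X a' b * Y a' b') := Finset.sum_comm
    _ = ∑ a, ∑ b, ∑ a', ∑ b', X a b * Y a b' * (X a' b * Y a' b') :=
        Finset.sum_congr rfl fun a _ => Finset.sum_congr rfl fun b _ => Finset.sum_comm
    _ = ∑ a, ∑ a', ∑ b, ∑ b', X a b * Y a b' * (X a' b * Y a' b') :=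
        Finset.sum_congr rfl fun a _ => Finset.sum_comm
    _ = ∑ a, ∑ a', ∑ b, ∑ b', Y a b * Y a' b * (X a b' * X a' b') := by
        refine Finset.sum_congr rfl fun a _ => Finset.sum_congr rfl fun a' _ => ?_
        rw [Finset.sum_comm]
        exact Finset.sum_congr rfl fun b _ => Finset.sum_congr rfl fun b' _ => by ring

theorem gram_transpose (X : A → B → ℝ) : gram (fun b a => X a b) = gram X := by
  have h := norm_gramVec_sq_eq_inner X X
  rw [real_inner_self_eq_norm_sq] at h
  exact ((pow_left_inj₀ (norm_nonneg _) (norm_nonneg _) two_ne_zero).1 h).symm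

theorem norm_gramVec_sq_le (X Y : A → B → ℝ) : ‖gramVec X Y‖ ^ 2 ≤ gram X * gram Y := by
  rw [norm_gramVec_sq_eq_inner, ← gram_transpose X, ← gram_transpose Y]
  exact real_inner_le_norm _ _

theorem norm_gramVec_le (X Y : A → B → ℝ) : ‖gramVec X Y‖ ≤ √(gram X * gram Y) :=
  Real.le_sqrt_of_sq_le (norm_gramVec_sq_le X Y)

theorem gram_add (S d : A → B → ℝ) : gram (S + d) =
    ‖(gramVec S S + gramVec d d) + (gramVec S d + gramVec d S)‖ := by
  rw [gram, gramVec_add, gramVec_add_right, gramVec_add_right]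
  congr 1
  abel

theorem gram_sub (S d : A → B → ℝ) : gram (S - d) =
    ‖(gramVec S S + gramVec d d) - (gramVec S d + gramVec d S)‖ := by
  rw [sub_eq_add_neg, gram_add, gramVec_neg, gramVec_neg_right, gramVec_neg, gramVec_neg_right,
    neg_neg]
  congr 1
  abel

theorem norm_gramVec_cross_le (S d : A → B → ℝ) :
    ‖gramVec S d + gramVec d S‖ ≤ 2 * √(gram S * gram d) := by
  have h1 := norm_gramVec_le S d
  have h2 := norm_gramVec_le d S
  rw [mul_comm (gram d)] at h2
  linarith [norm_add_le (gramVec S d) (gramVec d S)]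

/-- Two-uniform smoothness of the Schatten `4`-norm. -/
theorem gram_add_add_gram_sub_le (S d : A → B → ℝ) :
    gram (S + d) + gram (S - d) ≤ 2 * gram S + 6 * gram d := by
  have hS := gram_nonneg S
  have hd := gram_nonneg d
  have hpar := parallelogram_law_with_norm ℝ (gramVec S S + gramVec d d)
    (gramVec S d + gramVec d S)
  rw [← gram_add, ← gram_sub] at hpar
  have h1 : ‖gramVec S S + gramVec d d‖ ≤ gram S + gram d := norm_add_le _ _
  have h2 := norm_gramVec_cross_le S d
  have h3 : ‖gramVec S S + gramVec d d‖ ^ 2 ≤ (gram S + gram d) ^ 2 := by gcongr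
  have h4 : ‖gramVec S d + gramVec d S‖ ^ 2 ≤ 4 * (gram S * gram d) := by
    calc _ ≤ (2 * √(gram S * gram d)) ^ 2 := by gcongr
      _ = _ := by rw [mul_pow, Real.sq_sqrt (by positivity)]; norm_num
  -- The square of the left side is at most twice the sum of squares, hence by the parallelogram law
  -- at most `4 (gram S + gram d)² + 16 gram S gram d`.
  refine abs_le_of_sq_le_sq' ?_ (by positivity) |>.2
  nlinarith [sq_nonneg (gram (S + d) - gram (S - d)), mul_nonneg hS hd, sq_nonneg (gram d)]

theorem abs_gram_add_sub_gram_sub_le (S d : A → B → ℝ) :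
    |gram (S + d) - gram (S - d)| ≤ 4 * √(gram S * gram d) := by
  rw [gram_add, gram_sub]
  refine (abs_norm_sub_norm_le _ _).trans ?_
  rw [add_sub_sub_cancel, ← two_smul ℝ, norm_smul]
  have := norm_gramVec_cross_le S d
  rw [Real.norm_of_nonneg zero_le_two]
  linarith

/-- The left side is `⟨X Xᵀ, w wᵀ⟩`. This is how `gram X` serves as a bound for the squared operator
norm. -/
theorem sum_inner_sq_le_gram (X : A → B → ℝ) (w : A → ℝ) :
    ∑ b, (∑ a, X a b * w a) ^ 2 ≤ gram X * ∑ a, w a ^ 2 := by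
  have h1 : ∑ b, (∑ a, X a b * w a) ^ 2 =
      inner ℝ (gramVec (fun b a => X a b) (fun b a => X a b))
        (gramVec (fun _ : Unit => w) (fun _ : Unit => w)) := by
    rw [PiLp.inner_apply, Fintype.sum_prod_type]
    simp_rw [pow_two, Finset.sum_mul_sum]
    rw [Finset.sum_comm]
    refine Finset.sum_congr rfl fun a _ => ?_
    rw [Finset.sum_comm]
    refine Finset.sum_congr rfl fun a' _ => ?_
    simp only [gramVec, RCLike.inner_apply, conj_trivial, Finset.univ_unique,
      Finset.sum_singleton, Finset.mul_sum]
    exact Finset.sum_congr rfl fun b _ => by ring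
  have h2 : gram (fun _ : Unit => w) = ∑ a, w a ^ 2 := by
    rw [← gram_transpose, ← pow_left_inj₀ (gram_nonneg _) (by positivity) two_ne_zero, gram_sq]
    simp [pow_two]
  rw [h1, ← gram_transpose X, ← h2]
  exact real_inner_le_norm _ _

end Gram

/-! ### Matrix martingales in the Schatten 4-norm. -/

section GramMartingale

variable {Ω A B : Type*} [Fintype A] [Fintype B]

/-- The part of the increment of `gram` that is odd in `d l` is itself a scalar martingale
difference; the even part is bounded by uniform smoothness. -/
theorem isHaar_gram_diff {τ : ℕ → Equiv.Perm Ω} {d : ℕ → Ω → A → B → ℝ}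
    (hd : ∀ l a b, IsHaar τ l (fun ω => d l ω a b)) (l : ℕ) :
    IsHaar τ l (fun ω => (gram ((∑ i ∈ Finset.range l, d i ω) + d l ω) -
      gram ((∑ i ∈ Finset.range l, d i ω) - d l ω)) / 2) := by
  have hinv : ∀ i l', i < l' → ∀ ω, d i (τ l' ω) = d i ω := fun i l' hi ω => by
    ext a b; exact (hd i a b).invariant l' hi ω
  have hodd : ∀ ω, d l (τ l ω) = -d l ω := fun ω => by
    ext a b; exact (hd l a b).odd ω
  have hsum : ∀ l', l ≤ l' → ∀ ω,
      ∑ i ∈ Finset.range l, d i (τ l' ω) = ∑ i ∈ Finset.range l, d i ω := fun l' hl ω =>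
    Finset.sum_congr rfl fun i hi => hinv i l' ((Finset.mem_range.1 hi).trans_le hl) ω
  refine ⟨fun ω => ?_, fun l' hl ω => ?_⟩
  · rw [hsum l le_rfl, hodd, sub_neg_eq_add, ← sub_eq_add_neg]
    ring
  · rw [hsum l' hl.le, hinv l l' hl]

variable [Fintype Ω]

/-- Sums of matrix martingale differences in the Schatten `4`-norm. -/
theorem exceptProb_gram_sum_range {τ : ℕ → Equiv.Perm Ω} {d : ℕ → Ω → A → B → ℝ}
    (hd : ∀ l a b, IsHaar τ l (fun ω => d l ω a b)) (L : ℕ) {p Φ : ℝ} (hp : 1 ≤ p)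
    (hΦ : 0 < Φ) :
    ExceptProb (L * Real.exp (-p)) (fun ω => (∀ l < L, gram (d l ω) ≤ Φ) →
      gram (∑ l ∈ Finset.range L, d l ω) ≤ 16 * p * L * Φ) := by
  rcases Nat.eq_zero_or_pos L with rfl | hL
  · refine ExceptProb.of_forall (by simp) fun ω _ => ?_
    have : gram (0 : A → B → ℝ) ^ 2 = 0 := by rw [gram_sq]; simp
    simp [pow_eq_zero_iff two_ne_zero |>.1 this]
  have hL' : (0 : ℝ) < L := by exact_mod_cast hL
  set S : ℕ → Ω → A → B → ℝ := fun l ω => ∑ i ∈ Finset.range l, d i ω with hS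
  set O : ℕ → Ω → ℝ := fun l ω => (gram (S l ω + d l ω) - gram (S l ω - d l ω)) / 2 with hO
  have hOH : ∀ l, IsHaar τ l (O l) := isHaar_gram_diff hd
  have hc : 0 < 1 / (8 * L * Φ) := by positivity
  have hev := ExceptProb.forall_finset (Finset.range L) fun l _ =>
    exceptProb_martingale_le hOH (Finset.range (l + 1)) hc p
  rw [Finset.card_range] at hev
  refine hev.mono le_rfl fun ω hω hdΦ => ?_
  set K : ℝ := 16 * p * L * Φ with hK
  have hK0 : 0 < K := by positivity
  have hgrow : ∀ l ≤ L, gram (S l ω) ≤ 3 * l * Φ + ∑ i ∈ Finset.range l, O i ω := by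
    intro l
    induction l with
    | zero =>
      intro _
      have : gram (0 : A → B → ℝ) ^ 2 = 0 := by rw [gram_sq]; simp
      simp [hS, pow_eq_zero_iff two_ne_zero |>.1 this]
    | succ l ih =>
      intro hl
      have h1 := ih (by omega)
      have h2 := gram_add_add_gram_sub_le (S l ω) (d l ω)
      have h3 : S (l + 1) ω = S l ω + d l ω := Finset.sum_range_succ _ _
      have h4 := hdΦ l (by omega)
      rw [h3, Finset.sum_range_succ]
      push_cast
      simp only [hO]
      linarith
  -- Bootstrap. If all earlier partial sums have `gram` at most `K`, then `∑ O i ω ^ 2 ≤ 4 * L * K *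
  -- Φ`. With `c = 1 / (8 * L * Φ)` the martingale contributes at most `K / 4 + K / 2` and the drift
  -- at most `3 * K / 16`.
  have hmain : ∀ l ≤ L, gram (S l ω) ≤ K := by
    intro l
    induction l using Nat.strong_induction_on with
    | _ l ih =>
      intro hl
      rcases Nat.eq_zero_or_pos l with rfl | hl0
      · have := hgrow 0 (by omega)
        simp only [Nat.cast_zero, mul_zero, zero_mul, Finset.range_zero, Finset.sum_empty,
          add_zero] at this
        linarith
      have h1 := hω (l - 1) (Finset.mem_range.2 (by omega))
      rw [Nat.sub_add_cancel hl0] at h1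
      have h2 : ∑ i ∈ Finset.range l, O i ω ^ 2 ≤ L * (4 * (K * Φ)) := by
        calc _ ≤ ∑ i ∈ Finset.range l, 4 * (K * Φ) := by
              refine Finset.sum_le_sum fun i hi => ?_
              have hi' := Finset.mem_range.1 hi
              have h5 := abs_gram_add_sub_gram_sub_le (S i ω) (d i ω)
              have h6 : |O i ω| ≤ 2 * √(gram (S i ω) * gram (d i ω)) := by
                simp only [hO]
                rw [abs_div, abs_two]
                linarith
              have h7 : gram (S i ω) * gram (d i ω) ≤ K * Φ :=
                mul_le_mul (ih i hi' (by omega)) (hdΦ i (by omega)) (gram_nonneg _) hK0.le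
              have h8 : 0 ≤ gram (S i ω) * gram (d i ω) :=
                mul_nonneg (gram_nonneg _) (gram_nonneg _)
              calc O i ω ^ 2 = |O i ω| ^ 2 := (sq_abs _).symm
                _ ≤ (2 * √(gram (S i ω) * gram (d i ω))) ^ 2 := by gcongr
                _ = 4 * (gram (S i ω) * gram (d i ω)) := by
                  rw [mul_pow, Real.sq_sqrt h8]; norm_num
                _ ≤ _ := by linarith
          _ = l * (4 * (K * Φ)) := by simp
          _ ≤ _ := by gcongr
      have h3 : 1 / (8 * L * Φ) / 2 * ∑ i ∈ Finset.range l, O i ω ^ 2 ≤ K / 4 := by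
        calc _ ≤ 1 / (8 * L * Φ) / 2 * (L * (4 * (K * Φ))) := by gcongr
          _ = K / 4 := by field_simp; norm_num
      have h4 : p / (1 / (8 * L * Φ)) = K / 2 := by rw [hK]; field_simp; norm_num
      have h5 : 3 * l * Φ ≤ 3 * (K / 16) := by
        have : (l : ℝ) ≤ p * L := by
          have : (l : ℝ) ≤ L := by exact_mod_cast hl
          nlinarith
        rw [hK]
        nlinarith
      have h6 := hgrow l hl
      linarith
  exact hmain L le_rfl

theorem Fin.sum_univ_cons_pi {ι M : Type*} [Fintype ι] [AddCommMonoid M] {e : ℕ}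
    (g : (Fin (e + 1) → ι) → M) :
    ∑ ρ, g ρ = ∑ l, ∑ ρ : Fin e → ι, g (Fin.cons l ρ) := by
  rw [← (Fin.consEquiv fun _ : Fin (e + 1) => ι).sum_comp, Fintype.sum_prod_type]
  rfl

/-- Multi-parameter sums of matrices in the Schatten `4`-norm. -/
theorem exceptProb_gram_sum {L : ℕ} {p Φ : ℝ} (hp : 1 ≤ p) (hΦ : 0 < Φ) (e : ℕ)
    {τ : Fin e → ℕ → Equiv.Perm Ω} {M : (Fin e → Fin L) → Ω → A → B → ℝ}
    (hM : ∀ ρ i a b, IsHaar (τ i) (ρ i) (fun ω => M ρ ω a b)) :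
    ExceptProb (e * (L : ℝ) ^ e * Real.exp (-p)) (fun ω => (∀ ρ, gram (M ρ ω) ≤ Φ) →
      gram (∑ ρ, M ρ ω) ≤ (16 * p * L) ^ e * Φ) := by
  induction e with
  | zero =>
    refine ExceptProb.of_forall (by simp) fun ω h => ?_
    simpa using h default
  | succ e ih =>
    rcases Nat.eq_zero_or_pos L with rfl | hL
    · refine ExceptProb.of_forall (by simp) fun ω _ => ?_
      have : gram (0 : A → B → ℝ) ^ 2 = 0 := by rw [gram_sq]; simp
      simp [pow_eq_zero_iff two_ne_zero |>.1 this]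
    have hL' : (1 : ℝ) ≤ L := by exact_mod_cast hL
    have h1 := ExceptProb.forall_fintype fun l : Fin L =>
      ih (τ := fun i => τ i.succ) (M := fun ρ => M (Fin.cons l ρ))
        (fun ρ i a b => by simpa using hM (Fin.cons l ρ) i.succ a b)
    set d : ℕ → Ω → A → B → ℝ := fun l ω =>
      if h : l < L then ∑ ρ : Fin e → Fin L, M (Fin.cons ⟨l, h⟩ ρ) ω else 0 with hd
    have hdH : ∀ l a b, IsHaar (τ 0) l (fun ω => d l ω a b) := by
      intro l a b
      by_cases h : l < L
      · simp only [hd, h, dif_pos, Finset.sum_apply]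
        exact IsHaar.sum _ fun ρ _ => by simpa using hM (Fin.cons ⟨l, h⟩ ρ) 0 a b
      · simp only [hd, h, dif_neg, not_false_eq_true, Pi.zero_apply]
        exact IsHaar.zero
    have h2 := exceptProb_gram_sum_range hdH L hp (show 0 < (16 * p * L) ^ e * Φ by positivity)
    refine (h1.and h2).mono ?_ fun ω hω hΦω => ?_
    · rw [Fintype.card_fin]
      have : (L : ℝ) ≤ (L : ℝ) ^ (e + 1) := le_self_pow₀ hL' (by omega)
      have h3 := mul_le_mul_of_nonneg_right this (Real.exp_pos (-p)).le
      push_cast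
      calc (L : ℝ) * (e * (L : ℝ) ^ e * Real.exp (-p)) + L * Real.exp (-p)
          ≤ (L : ℝ) * (e * (L : ℝ) ^ e * Real.exp (-p)) + (L : ℝ) ^ (e + 1) * Real.exp (-p) := by
            linarith
        _ = _ := by ring
    · have h3 : ∑ ρ, M ρ ω = ∑ l ∈ Finset.range L, d l ω := by
        rw [Fin.sum_univ_cons_pi, Finset.sum_range]
        refine Finset.sum_congr rfl fun l _ => ?_
        simp [hd]
      rw [h3]
      refine (hω.2 fun l hl => ?_).trans_eq (by ring)
      simp only [hd, hl, dif_pos]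
      exact hω.1 ⟨l, hl⟩ fun ρ => hΦω _

end GramMartingale

/-! ### Near orthogonality of columns through the forced coordinate. -/

section Correlation

variable {Ω A : Type*} [Fintype Ω] [Fintype A]

/-- As `u a < u' a`, the level of `g a` in the forced coordinate is lower than that of `f a`, so `f
a * g a` is still Haar at the level of `f a`. Grouping by this level gives a martingale with at most
`n + 1` differences, each bounded by `Y`. -/
theorem exceptProb_sum_mul_le {n : ℕ} {σ : ℕ → Equiv.Perm Ω} {f g : A → Ω → ℝ} {u u' : A → ℕ}
    {Y p : ℝ} (hY : 0 < Y) (hp : 0 < p)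
    (hf : ∀ a v, u a + v = n → IsHaar σ v (f a)) (hg : ∀ a v, u' a + v = n → IsHaar σ v (g a))
    (hf0 : ∀ a, n < u a → f a = 0) (hg0 : ∀ a, n < u' a → g a = 0)
    (hf1 : ∀ a ω, |f a ω| ≤ 1) (hg1 : ∀ a ω, |g a ω| ≤ 1) (huu' : ∀ a, u a < u' a)
    (hu : ∀ s, (({a | u a = s} : Set A).ncard : ℝ) ≤ Y) :
    ExceptProb (2 * Real.exp (-p))
      (fun ω => (∑ a, f a ω * g a ω) ^ 2 ≤ 2 * p * (n + 1) * Y ^ 2) := by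
  classical
  set D : ℕ → Ω → ℝ := fun v ω => ∑ a with u a + v = n, f a ω * g a ω with hD
  have hDH : ∀ v, IsHaar σ v (D v) := by
    intro v
    refine IsHaar.sum _ fun a ha => ?_
    have ha' : u a + v = n := (Finset.mem_filter.1 ha).2
    have key : ∀ l, v ≤ l → ∀ ω, g a (σ l ω) = g a ω := by
      intro l hl ω
      rcases lt_or_ge n (u' a) with h | h
      · simp [hg0 a h]
      · have := huu' a
        exact (hg a (n - u' a) (by omega)).invariant l (by omega) ω
    exact (hf a v ha').mul_invariant (key v le_rfl) fun l hl => key l hl.le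
  have hsum : ∀ ω, ∑ a, f a ω * g a ω = ∑ v ∈ Finset.range (n + 1), D v ω := by
    intro ω
    simp only [hD, Finset.sum_filter]
    rw [Finset.sum_comm]
    refine Finset.sum_congr rfl fun a _ => ?_
    rcases lt_or_ge n (u a) with h | h
    · simp [hf0 a h]
    · rw [Finset.sum_eq_single (n - u a)]
      · rw [if_pos (by omega)]
      · intro v _ hv
        rw [if_neg (by omega)]
      · intro hv
        exact absurd (Finset.mem_range.2 (by omega)) hv
  have hDle : ∀ v ω, D v ω ^ 2 ≤ Y ^ 2 := by
    intro v ω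
    rw [sq_le_sq, abs_of_pos hY]
    calc |D v ω| ≤ ∑ a with u a + v = n, |f a ω * g a ω| := Finset.abs_sum_le_sum_abs _ _
      _ ≤ ∑ a with u a + v = n, 1 := Finset.sum_le_sum fun a _ => by
          rw [abs_mul]; exact mul_le_one₀ (hf1 a ω) (abs_nonneg _) (hg1 a ω)
      _ = ((Finset.univ.filter fun a => u a + v = n).card : ℝ) := by simp
      _ ≤ (({a | u a = n - v} : Set A).ncard : ℝ) := by
          rw [← Set.ncard_coe_finset]
          refine Nat.cast_le.2 (Set.ncard_le_ncard (fun a ha => ?_) (Set.toFinite _))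
          have : u a + v = n := by simpa using ha
          show u a = n - v
          omega
      _ ≤ Y := hu _
  have hL : (0 : ℝ) < n + 1 := by positivity
  set t : ℝ := √(2 * p * (n + 1) * Y ^ 2) with ht
  have ht2 : t ^ 2 = 2 * p * (n + 1) * Y ^ 2 := Real.sq_sqrt (by positivity)
  -- The choice `c = 2 * p / t` balances the two terms of the martingale bound at `t / 2` each.
  have ht0 : 0 < t := Real.sqrt_pos.2 (by positivity)
  have hc : 0 < 2 * p / t := by positivity
  have hbound : ∀ ω, 2 * p / t / 2 * ∑ v ∈ Finset.range (n + 1), D v ω ^ 2 + p / (2 * p / t)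
      ≤ t := by
    intro ω
    have h1 : ∑ v ∈ Finset.range (n + 1), D v ω ^ 2 ≤ (n + 1) * Y ^ 2 := by
      refine (Finset.sum_le_sum fun v _ => hDle v ω).trans_eq ?_
      simp
    have h2 : 2 * p / t / 2 * ∑ v ∈ Finset.range (n + 1), D v ω ^ 2 ≤
        2 * p / t / 2 * ((n + 1) * Y ^ 2) := by gcongr
    have h3 : 2 * p / t / 2 * ((n + 1) * Y ^ 2) = t / 2 := by
      field_simp
      linarith
    have h4 : p / (2 * p / t) = t / 2 := by field_simp
    linarith
  refine ((exceptProb_martingale_le hDH (Finset.range (n + 1)) hc p).and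
    (exceptProb_martingale_le (fun v => (hDH v).neg) (Finset.range (n + 1)) hc p)).mono
    (by linarith) fun ω hω => ?_
  have h1 := hω.1.trans (hbound ω)
  have h2 := hω.2
  simp only [neg_sq, Finset.sum_neg_distrib] at h2
  have h3 := h2.trans (hbound ω)
  rw [hsum, ← ht2]
  exact sq_le_sq' (by linarith) h1

end Correlation

/-- A family of functions indexed by the levels `ρ` in some coordinates and by `a`, where `a`
records levels of total weight `w a` in further coordinates, and where the level of one last
coordinate, with flips `σ`, is determined by the total level `n`. -/
structure IsHaarFamily {Ω A : Type*} (n : ℕ) {e : ℕ} (σ : ℕ → Equiv.Perm Ω)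
    (τ : Fin e → ℕ → Equiv.Perm Ω) (w : A → ℕ) (F : A → (Fin e → Fin (n + 1)) → Ω → ℝ) :
    Prop where
  haar : ∀ a ρ i, IsHaar (τ i) (ρ i : ℕ) (F a ρ)
  haar_last : ∀ a ρ v, w a + ∑ i, (ρ i : ℕ) + v = n → IsHaar σ v (F a ρ)
  eq_zero : ∀ a ρ, n < w a + ∑ i, (ρ i : ℕ) → F a ρ = 0
  abs_le_one : ∀ a ρ ω, |F a ρ ω| ≤ 1

namespace IsHaarFamily

variable {Ω A : Type*} {n e : ℕ} {σ : ℕ → Equiv.Perm Ω} {w : A → ℕ}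
  {Y p : ℝ}

/-- Move the first free coordinate to the recorded ones. -/
theorem cons {τ : Fin (e + 1) → ℕ → Equiv.Perm Ω}
    {F : A → (Fin (e + 1) → Fin (n + 1)) → Ω → ℝ} (h : IsHaarFamily n σ τ w F) :
    IsHaarFamily n σ (fun i => τ i.succ) (fun q : A × Fin (n + 1) => w q.1 + q.2)
      (fun q ρ => F q.1 (Fin.cons q.2 ρ)) where
  haar q ρ i := by simpa using h.haar q.1 (Fin.cons q.2 ρ) i.succ
  haar_last q ρ v hv := h.haar_last q.1 (Fin.cons q.2 ρ) v (by
    rw [Fin.sum_univ_succ]; simpa [add_assoc] using hv)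
  eq_zero q ρ hq := h.eq_zero q.1 (Fin.cons q.2 ρ) (by
    rw [Fin.sum_univ_succ]; simpa [add_assoc] using hq)
  abs_le_one q ρ ω := h.abs_le_one _ _ ω

variable [Fintype Ω] [Fintype A] {τ : Fin (e + 1) → ℕ → Equiv.Perm Ω}
  {F : A → (Fin (e + 1) → Fin (n + 1)) → Ω → ℝ}

theorem exceptProb_correlation (h : IsHaarFamily n σ τ w F) (hY : 0 < Y) (hp : 0 < p)
    (hw : ∀ s, (({a | w a = s} : Set A).ncard : ℝ) ≤ Y) (ρ : Fin e → Fin (n + 1))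
    {k k' : Fin (n + 1)} (hk : k < k') :
    ExceptProb (2 * Real.exp (-p)) (fun ω =>
      (∑ a, F a (Fin.cons k ρ) ω * F a (Fin.cons k' ρ) ω) ^ 2 ≤ 2 * p * (n + 1) * Y ^ 2) := by
  refine exceptProb_sum_mul_le (σ := σ) (u := fun a => w a + (k + ∑ i, (ρ i : ℕ)))
    (u' := fun a => w a + (k' + ∑ i, (ρ i : ℕ))) hY hp
    (fun a v hv => h.haar_last a (Fin.cons k ρ) v ?_)
    (fun a v hv => h.haar_last a (Fin.cons k' ρ) v ?_)
    (fun a ha => h.eq_zero a (Fin.cons k ρ) ?_) (fun a ha => h.eq_zero a (Fin.cons k' ρ) ?_)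
    (fun a ω => h.abs_le_one _ _ ω) (fun a ω => h.abs_le_one _ _ ω) ?_ ?_
  · rw [Fin.sum_univ_succ]; simpa [add_assoc] using hv
  · rw [Fin.sum_univ_succ]; simpa [add_assoc] using hv
  · rw [Fin.sum_univ_succ]; simpa [add_assoc] using ha
  · rw [Fin.sum_univ_succ]; simpa [add_assoc] using ha
  · intro a
    have : (k : ℕ) < k' := hk
    omega
  · intro s
    refine le_trans (Nat.cast_le.2 (Set.ncard_le_ncard (fun a ha => ?_) (Set.toFinite _)))
      (hw (s - (k + ∑ i, (ρ i : ℕ))))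
    have : w a + (k + ∑ i, (ρ i : ℕ)) = s := ha
    show w a = s - (k + ∑ i, (ρ i : ℕ))
    omega

/-- The `n + 1` diagonal entries of the Gram matrix are at most `(n + 1) * Y`, and off the diagonal
the squares are at most `2 * p * (n + 1) * Y ^ 2`. Both kinds contribute order `(n + 1) ^ 3 * Y ^ 2`
up to `p`, a gain of `√(n + 1)` in `gram` over the trivial bound. -/
theorem exceptProb_gram_slice (h : IsHaarFamily n σ τ w F) (hY : 0 < Y) (hp : 1 ≤ p)
    (hw : ∀ s, (({a | w a = s} : Set A).ncard : ℝ) ≤ Y)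
    (hA : (Fintype.card A : ℝ) ≤ (n + 1) * Y) :
    ExceptProb (2 * ((n : ℝ) + 1) ^ (e + 2) * Real.exp (-p)) (fun ω =>
      ∀ ρ : Fin e → Fin (n + 1), gram (fun a k => F a (Fin.cons k ρ) ω) ≤
        2 * p * ((n + 1) * √(n + 1)) * Y) := by
  have hp0 : 0 < p := by linarith
  have h1 := ExceptProb.forall_fintype fun q : (Fin e → Fin (n + 1)) × Fin (n + 1) × Fin (n + 1) =>
    show ExceptProb (2 * Real.exp (-p)) (fun ω => q.2.1 ≠ q.2.2 →
      (∑ a, F a (Fin.cons q.2.1 q.1) ω * F a (Fin.cons q.2.2 q.1) ω) ^ 2 ≤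
        2 * p * (n + 1) * Y ^ 2) by
    rcases lt_trichotomy q.2.1 q.2.2 with hk | hk | hk
    · exact (h.exceptProb_correlation hY hp0 hw q.1 hk).mono le_rfl fun ω hω _ => hω
    · exact ExceptProb.of_forall (by positivity) fun ω hne => absurd hk hne
    · refine (h.exceptProb_correlation hY hp0 hw q.1 hk).mono le_rfl fun ω hω _ => ?_
      simpa only [mul_comm] using hω
  refine h1.mono (le_of_eq ?_) fun ω hω ρ => ?_
  · simp only [Fintype.card_prod, Fintype.card_pi, Fintype.card_fin, Finset.prod_const,
      Finset.card_univ]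
    push_cast
    ring
  · have hL : (0 : ℝ) < n + 1 := by positivity
    refine abs_le_of_sq_le_sq' ?_ (by positivity) |>.2
    rw [gram_sq]
    have h2 : ∀ k k' : Fin (n + 1), (∑ a, F a (Fin.cons k ρ) ω * F a (Fin.cons k' ρ) ω) ^ 2 ≤
        (if k = k' then ((n + 1) * Y) ^ 2 else 0) + 2 * p * (n + 1) * Y ^ 2 := by
      intro k k'
      by_cases hk : k = k'
      · rw [if_pos hk]
        have : |∑ a, F a (Fin.cons k ρ) ω * F a (Fin.cons k' ρ) ω| ≤ (n + 1) * Y := by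
          refine (Finset.abs_sum_le_sum_abs _ _).trans (le_trans ?_ hA)
          rw [Fintype.card_eq_sum_ones]
          push_cast
          refine Finset.sum_le_sum fun a _ => ?_
          rw [abs_mul]
          exact mul_le_one₀ (h.abs_le_one _ _ _) (abs_nonneg _) (h.abs_le_one _ _ _)
        have h3 := sq_le_sq' (abs_le.1 this).1 (abs_le.1 this).2
        have : 0 ≤ 2 * p * (n + 1) * Y ^ 2 := by positivity
        linarith
      · rw [if_neg hk, zero_add]
        exact hω (ρ, k, k') hk
    refine (Finset.sum_le_sum fun k _ => Finset.sum_le_sum fun k' _ => h2 k k').trans ?_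
    simp only [Finset.sum_add_distrib, Finset.sum_ite_eq, Finset.mem_univ, if_true,
      Finset.sum_const, Finset.card_univ, Fintype.card_fin, nsmul_eq_mul]
    push_cast
    have h4 : (2 * p * ((n + 1) * √(n + 1)) * Y) ^ 2 = 4 * p ^ 2 * ((n + 1 : ℝ) ^ 3 * Y ^ 2) := by
      have := Real.sq_sqrt hL.le
      calc _ = 4 * p ^ 2 * ((n + 1 : ℝ) ^ 2 * √(n + 1) ^ 2 * Y ^ 2) := by ring
        _ = _ := by rw [this]; ring
    rw [h4]
    have h5 : 0 ≤ (n + 1 : ℝ) ^ 3 * Y ^ 2 := by positivity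
    calc _ = (1 + 2 * p) * ((n + 1 : ℝ) ^ 3 * Y ^ 2) := by ring
      _ ≤ _ := mul_le_mul_of_nonneg_right (by nlinarith) h5

/-- The Schatten `4`-norm of the matrix obtained by summing over all coordinates but the first. -/
theorem exceptProb_gram (h : IsHaarFamily n σ τ w F) (hY : 0 < Y) (hp : 1 ≤ p)
    (hw : ∀ s, (({a | w a = s} : Set A).ncard : ℝ) ≤ Y)
    (hA : (Fintype.card A : ℝ) ≤ (n + 1) * Y) :
    ExceptProb ((e + 2) * ((n : ℝ) + 1) ^ (e + 2) * Real.exp (-p)) (fun ω =>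
      gram (fun a k => ∑ ρ : Fin e → Fin (n + 1), F a (Fin.cons k ρ) ω) ≤
        (16 * p * (n + 1)) ^ e * (2 * p * ((n + 1) * √(n + 1)) * Y)) := by
  have h1 := exceptProb_gram_sum hp
    (show 0 < 2 * p * ((n + 1) * √(n + 1)) * Y by positivity) e (L := n + 1)
    (τ := fun i => τ i.succ) (M := fun ρ ω a k => F a (Fin.cons k ρ) ω)
    (fun ρ i a k => by simpa using h.haar a (Fin.cons k ρ) i.succ)
  refine (h1.and (h.exceptProb_gram_slice hY hp hw hA)).mono ?_ fun ω hω => ?_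
  · push_cast
    have h2 : ((n : ℝ) + 1) ^ e ≤ ((n : ℝ) + 1) ^ (e + 2) :=
      pow_le_pow_right₀ (by linarith [Nat.cast_nonneg (α := ℝ) n]) (by omega)
    have h3 : (e : ℝ) * ((n : ℝ) + 1) ^ e * Real.exp (-p) ≤
      e * ((n : ℝ) + 1) ^ (e + 2) * Real.exp (-p) := by gcongr
    linarith
  · have h2 := hω.1 hω.2
    push_cast at h2
    convert h2 using 2
    ext a k
    simp [Finset.sum_apply]

end IsHaarFamily

/-! ### Vector martingales against their square functions, by dyadic blocks. -/

section Dyadic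

variable {A : Type*}

/-- The sum of the vectors `x k`, `k < L`, over the `b`-th dyadic block of length `2 ^ i`. -/
def blockSum (x : ℕ → A → ℝ) (L i b : ℕ) : A → ℝ :=
  fun a => ∑ k ∈ Finset.range L with k / 2 ^ i = b, x k a

theorem blockSum_succ (x : ℕ → A → ℝ) (L i b : ℕ) (a : A) :
    blockSum x L (i + 1) b a = blockSum x L i (2 * b) a + blockSum x L i (2 * b + 1) a := by
  unfold blockSum
  rw [← Finset.sum_union]
  · congr 1
    ext k
    have h : k / 2 ^ (i + 1) = k / 2 ^ i / 2 := by rw [pow_succ, Nat.div_div_eq_div_mul]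
    simp only [Finset.mem_filter, Finset.mem_union, ← and_or_left, h]
    exact and_congr_right fun _ => by omega
  · rw [Finset.disjoint_left]
    intro k hk hk'
    simp only [Finset.mem_filter] at hk hk'
    omega

theorem blockSum_eq_zero (x : ℕ → A → ℝ) {L b : ℕ} (i : ℕ) (hb : L ≤ b) (a : A) :
    blockSum x L i b a = 0 := by
  refine Finset.sum_eq_zero fun k hk => ?_
  have h1 := Finset.mem_filter.1 hk
  have h2 := Finset.mem_range.1 h1.1
  have h3 := Nat.div_le_self k (2 ^ i)
  omega

theorem sum_range_two_mul (g : ℕ → ℝ) (L : ℕ) :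
    ∑ b ∈ Finset.range (2 * L), g b = ∑ b ∈ Finset.range L, (g (2 * b) + g (2 * b + 1)) := by
  induction L with
  | zero => simp
  | succ L ih =>
    rw [show 2 * (L + 1) = 2 * L + 1 + 1 by ring, Finset.sum_range_succ, Finset.sum_range_succ, ih,
      Finset.sum_range_succ]
    ring

variable [Fintype A]

/-- The sum of the squared norms of the dyadic block sums at level `i`. -/
def blockEnergy (x : ℕ → A → ℝ) (L i : ℕ) : ℝ :=
  ∑ b ∈ Finset.range L, ∑ a, blockSum x L i b a ^ 2

theorem blockEnergy_nonneg (x : ℕ → A → ℝ) (L i : ℕ) : 0 ≤ blockEnergy x L i :=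
  Finset.sum_nonneg fun _ _ => Finset.sum_nonneg fun _ _ => sq_nonneg _

theorem blockEnergy_eq (x : ℕ → A → ℝ) (L i : ℕ) : blockEnergy x L i =
    ∑ b ∈ Finset.range L, (∑ a, blockSum x L i (2 * b) a ^ 2 +
      ∑ a, blockSum x L i (2 * b + 1) a ^ 2) := by
  rw [← sum_range_two_mul fun b => ∑ a, blockSum x L i b a ^ 2]
  refine Finset.sum_subset (Finset.range_mono (by omega)) fun b _ hb => ?_
  refine Finset.sum_eq_zero fun a _ => ?_
  rw [blockSum_eq_zero x i (by simpa using hb), zero_pow two_ne_zero]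

theorem blockEnergy_succ (x : ℕ → A → ℝ) (L i : ℕ) : blockEnergy x L (i + 1) =
    blockEnergy x L i + 2 * ∑ b ∈ Finset.range L,
      ∑ a, blockSum x L i (2 * b + 1) a * blockSum x L i (2 * b) a := by
  rw [blockEnergy_eq x L i, Finset.mul_sum, ← Finset.sum_add_distrib]
  refine Finset.sum_congr rfl fun b _ => ?_
  rw [Finset.mul_sum, ← Finset.sum_add_distrib, ← Finset.sum_add_distrib]
  exact Finset.sum_congr rfl fun a _ => by rw [blockSum_succ]; ring

theorem blockEnergy_zero (x : ℕ → A → ℝ) (L : ℕ) :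
    blockEnergy x L 0 = ∑ k ∈ Finset.range L, ∑ a, x k a ^ 2 := by
  refine Finset.sum_congr rfl fun b hb => Finset.sum_congr rfl fun a _ => ?_
  simp only [blockSum, pow_zero, Nat.div_one]
  rw [Finset.sum_filter, Finset.sum_ite_eq' _ b, if_pos hb]

theorem blockEnergy_top (x : ℕ → A → ℝ) {L J : ℕ} (hL : 0 < L) (hJ : L ≤ 2 ^ J) :
    blockEnergy x L J = ∑ a, (∑ k ∈ Finset.range L, x k a) ^ 2 := by
  have hdiv : ∀ k ∈ Finset.range L, k / 2 ^ J = 0 := fun k hk =>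
    Nat.div_eq_of_lt ((Finset.mem_range.1 hk).trans_le hJ)
  unfold blockEnergy
  rw [Finset.sum_eq_single 0]
  · refine Finset.sum_congr rfl fun a _ => ?_
    unfold blockSum
    rw [Finset.filter_true_of_mem hdiv]
  · intro b _ hb
    refine Finset.sum_eq_zero fun a _ => ?_
    unfold blockSum
    rw [Finset.filter_false_of_mem fun k hk h => hb (by rw [← h, hdiv k hk])]
    simp
  · intro h
    exact absurd (Finset.mem_range.2 hL) h

variable {Ω : Type*} [Fintype Ω] {τ : ℕ → Equiv.Perm Ω} {x : ℕ → Ω → A → ℝ} {p Φ : ℝ}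

/-- Merging siblings adds twice their inner product. Expanding the right sibling into its terms
gives a scalar martingale, because the left one involves only earlier indices. By
`sum_inner_sq_le_gram` its square function is at most `Φ` times the energy, so `c = ε / Φ` makes the
loss a fraction `ε` of the energy plus a constant. -/
theorem exceptProb_blockEnergy_succ (hx : ∀ k a, IsHaar τ k (fun ω => x k ω a)) (L i : ℕ)
    (hΦ : 0 < Φ) (p : ℝ) {ε : ℝ} (hε : 0 < ε) :
    ExceptProb (Real.exp (-p)) (fun ω => gram (fun a (k : Fin L) => x k ω a) ≤ Φ →
      (1 - ε) * blockEnergy (fun k => x k ω) L i - 2 * p * Φ / ε ≤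
        blockEnergy (fun k => x k ω) L (i + 1)) := by
  set bs : ℕ → Ω → A → ℝ := fun b ω => blockSum (fun k => x k ω) L i b with hbs
  set D : ℕ → Ω → ℝ := fun k ω => ∑ b ∈ Finset.range L,
    if k / 2 ^ i = 2 * b + 1 then ∑ a, x k ω a * bs (2 * b) ω a else 0 with hD
  have hDH : ∀ k, IsHaar τ k (D k) := by
    intro k
    refine IsHaar.sum _ fun b _ => ?_
    by_cases hk : k / 2 ^ i = 2 * b + 1
    · simp only [hk, if_true]
      have key : ∀ l, k ≤ l → ∀ a ω, bs (2 * b) (τ l ω) a = bs (2 * b) ω a := by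
        intro l hl a ω
        refine Finset.sum_congr rfl fun k' hk' => (hx k' a).invariant l ?_ ω
        have h1 := (Finset.mem_filter.1 hk').2
        refine lt_of_lt_of_le ?_ hl
        by_contra hcon
        have := Nat.div_le_div_right (c := 2 ^ i) (not_lt.1 hcon)
        omega
      exact IsHaar.sum _ fun a _ =>
        (hx k a).mul_invariant (key k le_rfl a) fun l hl => key l hl.le a
    · simp only [hk, if_false]
      exact IsHaar.zero
  have hsum : ∀ ω, ∑ k ∈ Finset.range L, D k ω =
      ∑ b ∈ Finset.range L, ∑ a, bs (2 * b + 1) ω a * bs (2 * b) ω a := by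
    intro ω
    simp only [hD]
    rw [Finset.sum_comm]
    refine Finset.sum_congr rfl fun b _ => ?_
    rw [← Finset.sum_filter, Finset.sum_comm]
    refine Finset.sum_congr rfl fun a _ => ?_
    rw [← Finset.sum_mul]
    rfl
  have hsq : ∀ ω, gram (fun a (k : Fin L) => x k ω a) ≤ Φ →
      ∑ k ∈ Finset.range L, D k ω ^ 2 ≤ Φ * blockEnergy (fun k => x k ω) L i := by
    intro ω hω
    have h1 : ∀ k, D k ω ^ 2 ≤ ∑ b ∈ Finset.range L, (∑ a, x k ω a * bs (2 * b) ω a) ^ 2 := by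
      intro k
      by_cases hk : ∃ b ∈ Finset.range L, k / 2 ^ i = 2 * b + 1
      · obtain ⟨b, hb, hkb⟩ := hk
        have h2 : D k ω = ∑ a, x k ω a * bs (2 * b) ω a := by
          simp only [hD]
          rw [Finset.sum_eq_single b, if_pos hkb]
          · intro b' _ hb'
            rw [if_neg (by omega)]
          · exact fun h => absurd hb h
        rw [h2]
        exact Finset.single_le_sum
          (f := fun b => (∑ a, x k ω a * bs (2 * b) ω a) ^ 2) (fun _ _ => sq_nonneg _) hb
      · have h2 : D k ω = 0 := Finset.sum_eq_zero fun b hb => if_neg fun h => hk ⟨b, hb, h⟩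
        rw [h2, zero_pow two_ne_zero]
        exact Finset.sum_nonneg fun _ _ => sq_nonneg _
    calc ∑ k ∈ Finset.range L, D k ω ^ 2
        ≤ ∑ k ∈ Finset.range L, ∑ b ∈ Finset.range L, (∑ a, x k ω a * bs (2 * b) ω a) ^ 2 :=
          Finset.sum_le_sum fun k _ => h1 k
      _ = ∑ b ∈ Finset.range L, ∑ k ∈ Finset.range L, (∑ a, x k ω a * bs (2 * b) ω a) ^ 2 :=
          Finset.sum_comm
      _ ≤ ∑ b ∈ Finset.range L, Φ * ∑ a, bs (2 * b) ω a ^ 2 := by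
          refine Finset.sum_le_sum fun b _ => ?_
          rw [Finset.sum_range fun k => (∑ a, x k ω a * bs (2 * b) ω a) ^ 2]
          refine (sum_inner_sq_le_gram (fun a (k : Fin L) => x k ω a) (bs (2 * b) ω)).trans ?_
          exact mul_le_mul_of_nonneg_right hω (Finset.sum_nonneg fun _ _ => sq_nonneg _)
      _ = Φ * ∑ b ∈ Finset.range L, ∑ a, bs (2 * b) ω a ^ 2 := by rw [Finset.mul_sum]
      _ ≤ Φ * blockEnergy (fun k => x k ω) L i := by
          refine mul_le_mul_of_nonneg_left ?_ hΦ.le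
          rw [blockEnergy_eq]
          refine Finset.sum_le_sum fun b _ => ?_
          exact le_add_of_nonneg_right (Finset.sum_nonneg fun _ _ => sq_nonneg _)
  refine (exceptProb_martingale_le (fun k => (hDH k).neg) (Finset.range L)
    (div_pos hε hΦ) p).mono le_rfl fun ω hω hg => ?_
  simp only [neg_sq, Finset.sum_neg_distrib] at hω
  rw [hsum] at hω
  have h1 : ε / Φ / 2 * ∑ k ∈ Finset.range L, D k ω ^ 2 ≤
      ε / Φ / 2 * (Φ * blockEnergy (fun k => x k ω) L i) := by
    have := hsq ω hg
    gcongr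
  have h2 : ε / Φ / 2 * (Φ * blockEnergy (fun k => x k ω) L i) =
      ε / 2 * blockEnergy (fun k => x k ω) L i := by
    field_simp
  have h3 : p / (ε / Φ) = p * Φ / ε := by field_simp
  have h4 : 2 * p * Φ / ε = 2 * (p * Φ / ε) := by ring
  rw [blockEnergy_succ, h4]
  simp only [hbs] at hω
  linarith

/-- A vector-valued martingale is rarely much shorter than its square function. -/
theorem exceptProb_sq_sum_ge (hx : ∀ k a, IsHaar τ k (fun ω => x k ω a)) {L J : ℕ} (hL : 0 < L)
    (hLJ : L ≤ 2 ^ J) (hJ : 0 < J) (hΦ : 0 < Φ) (hp : 0 < p) {δ : ℝ} (hδ : 0 < δ) (hδ1 : δ ≤ 1) :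
    ExceptProb (J * Real.exp (-p)) (fun ω => gram (fun a (k : Fin L) => x k ω a) ≤ Φ →
      (1 - δ) * ∑ k ∈ Finset.range L, ∑ a, x k ω a ^ 2 - 2 * p * Φ * J ^ 2 / δ ≤
        ∑ a, (∑ k ∈ Finset.range L, x k ω a) ^ 2) := by
  have hJ0 : (0 : ℝ) < J := by exact_mod_cast hJ
  have hJ1 : (1 : ℝ) ≤ J := by exact_mod_cast hJ
  -- There are `J` merging steps, so each may lose a fraction `δ / J`.
  have hε : 0 < δ / J := by positivity
  have hε1 : δ / J ≤ 1 := (div_le_one hJ0).2 (hδ1.trans hJ1)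
  have h := ExceptProb.forall_finset (Finset.range J) fun i _ =>
    exceptProb_blockEnergy_succ hx L i hΦ p hε
  rw [Finset.card_range] at h
  refine h.mono le_rfl fun ω hω hg => ?_
  set S : ℕ → ℝ := fun i => blockEnergy (fun k => x k ω) L i with hS
  set r : ℝ := 2 * p * Φ / (δ / J) with hr
  have hr0 : 0 < r := by positivity
  have hind : ∀ i ≤ J, (1 - i * (δ / J)) * S 0 - i * r ≤ S i := by
    intro i
    induction i with
    | zero => intro _; simp
    | succ i ih =>
      intro hi
      have h1 := ih (by omega)
      have h2 := hω i (Finset.mem_range.2 (by omega)) hg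
      have h3 : 0 ≤ S 0 := blockEnergy_nonneg _ _ _
      have h4 : (1 - δ / J) * ((1 - i * (δ / J)) * S 0 - i * r) ≤ (1 - δ / J) * S i :=
        mul_le_mul_of_nonneg_left h1 (by linarith)
      have h5 : 0 ≤ i * (δ / J) ^ 2 * S 0 := by positivity
      have h6 : 0 ≤ δ / J * (i * r) := by positivity
      push_cast
      simp only [hS] at *
      linarith
  have h1 := hind J le_rfl
  have h2 : (J : ℝ) * (δ / J) = δ := by field_simp
  have h3 : (J : ℝ) * r = 2 * p * Φ * J ^ 2 / δ := by rw [hr]; field_simp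
  rw [h2, h3] at h1
  simp only [hS] at h1
  rwa [blockEnergy_zero, blockEnergy_top _ hL hLJ] at h1

end Dyadic

/-! ### Lower tail of the square function. -/

section SmallBall

variable {Ω : Type*} [Fintype Ω]

/-- The square function of a Haar family in the recorded coordinates is rarely much smaller than
its mean. -/
theorem IsHaarFamily.exceptProb_sq_sum_ge {n J : ℕ} (hJ : 0 < J) (hnJ : n + 1 ≤ 2 ^ J)
    {σ : ℕ → Equiv.Perm Ω} {p δ N : ℝ} (hp : 1 ≤ p) (hδ : 0 < δ) (hδ1 : δ ≤ 1) (hN : 0 ≤ N)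
    (e : ℕ) : ∀ {A : Type} [Fintype A] {w : A → ℕ} {Y : ℝ} {τ : Fin e → ℕ → Equiv.Perm Ω}
      {F : A → (Fin e → Fin (n + 1)) → Ω → ℝ},
      IsHaarFamily n σ τ w F → 0 < Y →
      (∀ s, (({a | w a = s} : Set A).ncard : ℝ) ≤ Y) →
      ((Fintype.card A : ℝ) ≤ (n + 1) * Y) →
      (∀ ω, ∑ a, ∑ ρ, F a ρ ω ^ 2 = N) →
      (2 * p * ((16 * p * (n + 1)) ^ e * (2 * p * √(n + 1) * Y)) * J ^ 2 / δ ≤ δ * N) →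
      ExceptProb (e * ((e + 1) * ((n : ℝ) + 1) ^ (e + 1) + J) * Real.exp (-p))
        (fun ω => (1 - 2 * e * δ) * N ≤ ∑ a, (∑ ρ, F a ρ ω) ^ 2) := by
  induction e with
  | zero =>
    intro A _ w Y τ F _ _ _ _ hsq _
    refine ExceptProb.of_forall (by simp) fun ω => ?_
    simp only [← hsq ω, CharP.cast_eq_zero, mul_zero, zero_mul, sub_zero, one_mul,
      Finset.univ_unique, Finset.sum_singleton, le_refl]
  | succ e ih =>
    intro A _ w Y τ F hF hY hw hA hsq hthr
    have hL : (0 : ℝ) < n + 1 := by positivity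
    have hL1 : (1 : ℝ) ≤ n + 1 := by linarith [Nat.cast_nonneg (α := ℝ) n]
    -- The first free coordinate joins the recorded ones. For a given total weight the index set
    -- grows by a factor of at most `n + 1`, while `N` is unchanged.
    have h1 := ih (Y := (n + 1) * Y) hF.cons (by positivity) (fun s => ?fib) ?card
      (fun ω => ?sq) ?thr
    case fib =>
      classical
      have h2 : (({q | w q.1 + q.2 = s} : Set (A × Fin (n + 1))).ncard : ℝ) ≤
          ∑ k : Fin (n + 1), (({a | w a + k = s} : Set A).ncard : ℝ) := by
        have h3 : ({q | w q.1 + q.2 = s} : Set (A × Fin (n + 1))) ⊆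
            ⋃ k : Fin (n + 1), (fun a => (a, k)) '' {a | w a + k = s} := by
          rintro ⟨a, k⟩ hq
          exact Set.mem_iUnion.2 ⟨k, a, hq, rfl⟩
        have h4 := Set.ncard_le_ncard h3 (Set.toFinite _)
        have h5 := Set.ncard_iUnion_le_of_fintype
          (fun k : Fin (n + 1) => (fun a => (a, k)) '' {a | w a + k = s})
        have h6 : ∀ k : Fin (n + 1), ((fun a => (a, k)) '' {a | w a + k = s}).ncard ≤
            ({a | w a + k = s} : Set A).ncard := fun k => Set.ncard_image_le (Set.toFinite _)
        exact_mod_cast h4.trans (h5.trans (Finset.sum_le_sum fun k _ => h6 k))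
      refine h2.trans ?_
      have h3 : ∀ k : Fin (n + 1), (({a | w a + k = s} : Set A).ncard : ℝ) ≤ Y := fun k => by
        refine le_trans (Nat.cast_le.2 (Set.ncard_le_ncard (fun a ha => ?_) (Set.toFinite _)))
          (hw (s - k))
        have : w a + k = s := ha
        show w a = s - k
        omega
      refine (Finset.sum_le_sum fun k _ => h3 k).trans_eq ?_
      simp
    case card =>
      rw [Fintype.card_prod, Fintype.card_fin]
      push_cast
      nlinarith
    case sq =>
      rw [← hsq ω, Fintype.sum_prod_type]
      refine Finset.sum_congr rfl fun a _ => ?_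
      rw [Fin.sum_univ_cons_pi]
    case thr =>
      refine le_trans ?_ hthr
      have h2 : (16 * p * (n + 1)) ^ e * (2 * p * √(n + 1) * ((n + 1) * Y)) ≤
          (16 * p * (n + 1)) ^ (e + 1) * (2 * p * √(n + 1) * Y) := by
        have h3 : 0 ≤ (16 * p * (n + 1)) ^ e * (2 * p * √(n + 1) * Y) * (n + 1) := by positivity
        calc _ = (16 * p * (n + 1)) ^ e * (2 * p * √(n + 1) * Y) * (n + 1) * 1 := by ring
          _ ≤ (16 * p * (n + 1)) ^ e * (2 * p * √(n + 1) * Y) * (n + 1) * (16 * p) :=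
            mul_le_mul_of_nonneg_left (by linarith) h3
          _ = _ := by ring
      gcongr
    set x : ℕ → Ω → A → ℝ := fun k ω a =>
      if h : k < n + 1 then ∑ ρ : Fin e → Fin (n + 1), F a (Fin.cons ⟨k, h⟩ ρ) ω else 0 with hx
    have hxH : ∀ k a, IsHaar (τ 0) k (fun ω => x k ω a) := by
      intro k a
      by_cases h : k < n + 1
      · simp only [hx, h, dif_pos]
        exact IsHaar.sum _ fun ρ _ => by simpa using hF.haar a (Fin.cons ⟨k, h⟩ ρ) 0
      · simp only [hx, h, dif_neg, not_false_eq_true]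
        exact IsHaar.zero
    set Φ : ℝ := (16 * p * (n + 1)) ^ e * (2 * p * ((n + 1) * √(n + 1)) * Y) with hΦ
    have hΦ0 : 0 < Φ := by positivity
    have h2 := hF.exceptProb_gram hY hp hw hA
    have h3 := _root_.exceptProb_sq_sum_ge hxH (Nat.succ_pos n) hnJ hJ hΦ0
      (show 0 < p by linarith) hδ hδ1
    refine (h1.and (h2.and h3)).mono ?_ fun ω hω => ?_
    · have h4 : (e : ℝ) * (((e : ℝ) + 1) * (n + 1) ^ (e + 1)) ≤
          e * (((e : ℝ) + 1 + 1) * (n + 1) ^ (e + 1 + 1)) := by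
        have : ((n : ℝ) + 1) ^ (e + 1) ≤ ((n : ℝ) + 1) ^ (e + 1 + 1) :=
          pow_le_pow_right₀ hL1 (by omega)
        gcongr
        linarith
      have h5 := mul_le_mul_of_nonneg_right h4 (Real.exp_pos (-p)).le
      push_cast
      have h6 : ((e : ℝ) + 1) * ((e + 1 + 1) * (n + 1) ^ (e + 1 + 1) + J) * Real.exp (-p) =
        e * ((e + 1 + 1) * (n + 1) ^ (e + 1 + 1)) * Real.exp (-p) + e * J * Real.exp (-p) +
          (((e : ℝ) + 2) * (n + 1) ^ (e + 2) * Real.exp (-p) + J * Real.exp (-p)) := by ring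
      rw [h6]
      linarith
    · obtain ⟨hω1, hω2, hω3⟩ := hω
      have hxF : ∀ a (k : Fin (n + 1)),
          x k ω a = ∑ ρ : Fin e → Fin (n + 1), F a (Fin.cons k ρ) ω := fun a k => by
        simp only [hx, k.isLt, dif_pos]
      have h4 := hω3 (by
        refine le_trans (le_of_eq ?_) hω2
        congr 1
        ext a k
        exact hxF a k)
      have h5 : ∑ a, (∑ k ∈ Finset.range (n + 1), x k ω a) ^ 2 = ∑ a, (∑ ρ, F a ρ ω) ^ 2 := by
        refine Finset.sum_congr rfl fun a _ => ?_
        rw [Fin.sum_univ_cons_pi, Finset.sum_range]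
        congr 1
        exact Finset.sum_congr rfl fun k _ => hxF a k
      have h6 : ∑ k ∈ Finset.range (n + 1), ∑ a, x k ω a ^ 2 =
          ∑ q : A × Fin (n + 1), (∑ ρ : Fin e → Fin (n + 1), F q.1 (Fin.cons q.2 ρ) ω) ^ 2 := by
        rw [Finset.sum_comm, Fintype.sum_prod_type]
        refine Finset.sum_congr rfl fun a _ => ?_
        rw [Finset.sum_range]
        exact Finset.sum_congr rfl fun k _ => by rw [hxF a k]
      have h7 : 2 * p * Φ * J ^ 2 / δ ≤ δ * N := by
        refine le_trans ?_ hthr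
        have h8 : Φ ≤ (16 * p * (n + 1)) ^ (e + 1) * (2 * p * √(n + 1) * Y) := by
          have h3 : 0 ≤ (16 * p * (n + 1)) ^ e * (2 * p * √(n + 1) * Y) * (n + 1) := by positivity
          calc Φ = (16 * p * (n + 1)) ^ e * (2 * p * √(n + 1) * Y) * (n + 1) * 1 := by
                rw [hΦ]; ring
            _ ≤ (16 * p * (n + 1)) ^ e * (2 * p * √(n + 1) * Y) * (n + 1) * (16 * p) :=
              mul_le_mul_of_nonneg_left (by linarith) h3
            _ = _ := by ring
        gcongr
      rw [h5, h6] at h4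
      refine le_trans ?_ h4
      -- Removing one coordinate costs a factor `1 - δ` and the error `δ * N`: `(1 - δ) * (1 - 2 * e
      -- * δ) - δ ≥ 1 - 2 * (e + 1) * δ`.
      have h9 := mul_le_mul_of_nonneg_left hω1 (show 0 ≤ 1 - δ by linarith)
      have h10 : 0 ≤ e * δ ^ 2 * N := by positivity
      push_cast
      nlinarith

end SmallBall

/-! ### From a large square function to a large value. -/

theorem ExceptProb.sum_le {Ω : Type*} [Fintype Ω] {x y : ℝ} {P : Ω → Prop} (h : ExceptProb x P)
    {g : Ω → ℝ} (hy : 0 ≤ y) (hg : ∀ ω, g ω ≤ 1) (hgP : ∀ ω, P ω → g ω ≤ y) :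
    ∑ ω, g ω ≤ (x + y) * Fintype.card Ω := by
  classical
  have h1 : ∀ ω, g ω ≤ (if ¬ P ω then 1 else 0) + y := fun ω => by
    by_cases hP : P ω
    · simpa [hP] using hgP ω hP
    · simpa [hP] using (hg ω).trans (by linarith)
  have h2 : ∑ ω, (if ¬ P ω then (1 : ℝ) else 0) = ({ω | ¬ P ω} : Set Ω).ncard := by
    have h3 : ({ω | ¬ P ω} : Set Ω) = ↑(Finset.univ.filter fun ω => ¬ P ω) := by
      ext; simp
    rw [h3, Set.ncard_coe_finset, Finset.sum_boole]
  have h4 := Finset.sum_le_sum fun ω (_ : ω ∈ Finset.univ) => h1 ω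
  rw [Finset.sum_add_distrib, h2, Finset.sum_const, Finset.card_univ, nsmul_eq_mul] at h4
  unfold ExceptProb at h
  linarith

theorem inv_cosh_le_one (y : ℝ) : (Real.cosh y)⁻¹ ≤ 1 := inv_le_one_of_one_le₀ (Real.one_le_cosh y)

theorem one_add_sq_div_two_le_cosh (y : ℝ) : 1 + y ^ 2 / 2 ≤ Real.cosh y := by
  have h1 : |y| / 2 ≤ Real.sinh (|y| / 2) := Real.self_le_sinh_iff.2 (by positivity)
  have h2 : Real.cosh y = 1 + 2 * Real.sinh (|y| / 2) ^ 2 := by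
    rw [← Real.cosh_abs, show |y| = 2 * (|y| / 2) by ring, Real.cosh_two_mul, Real.cosh_sq]
    ring_nf
  have h3 : (|y| / 2) ^ 2 ≤ Real.sinh (|y| / 2) ^ 2 := by gcongr
  rw [h2, ← sq_abs y]
  linarith

theorem inv_cosh_le {y : ℝ} (hy : y ^ 2 ≤ 1) : (Real.cosh y)⁻¹ ≤ Real.exp (-(y ^ 2 / 3)) := by
  rw [Real.exp_neg]
  refine inv_anti₀ (Real.exp_pos _) ?_
  have h0 := sq_nonneg y
  have h1 : |y ^ 2 / 3| ≤ 1 := by rw [abs_of_nonneg (by positivity)]; linarith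
  have h2 := (abs_le.1 (Real.abs_exp_sub_one_sub_id_le h1)).2
  have h3 : 1 + y ^ 2 / 2 ≤ Real.cosh y := one_add_sq_div_two_le_cosh y
  nlinarith

section Lower

variable {Ω : Type*} [Fintype Ω] {n e J : ℕ} {σ τ₀ : ℕ → Equiv.Perm Ω}
  {τ : Fin e → ℕ → Equiv.Perm Ω} {F : Fin (n + 1) → (Fin e → Fin (n + 1)) → Ω → ℝ} {p N : ℝ}

/-- Numbers are `1 × 1` matrices, for which `gram` is the square, so the matrix estimate applies. -/
theorem IsHaarFamily.exceptProb_sq_le {A : Type*} {w : A → ℕ}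
    {F : A → (Fin e → Fin (n + 1)) → Ω → ℝ} (h : IsHaarFamily n σ τ w F)
    (hp : 1 ≤ p) (a : A) :
    ExceptProb (e * ((n : ℝ) + 1) ^ e * Real.exp (-p))
      (fun ω => (∑ ρ, F a ρ ω) ^ 2 ≤ (16 * p * (n + 1)) ^ e) := by
  have h1 := exceptProb_gram_sum hp one_pos e (L := n + 1)
    (τ := τ) (M := fun ρ ω (_ _ : Unit) => F a ρ ω) (fun ρ i _ _ => h.haar a ρ i)
  have hgram : ∀ y : ℝ, gram (fun _ _ : Unit => y) = y ^ 2 := fun y => by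
    rw [← pow_left_inj₀ (gram_nonneg _) (sq_nonneg _) two_ne_zero, gram_sq]
    simp [pow_two]
  refine h1.mono (by push_cast; rfl) fun ω hω => ?_
  have h2 := hω fun ρ => by
    rw [hgram]
    exact (sq_le_one_iff_abs_le_one _).2 (h.abs_le_one a ρ ω)
  have h3 : (∑ ρ, fun _ _ : Unit => F a ρ ω) = fun _ _ : Unit => ∑ ρ, F a ρ ω := by
    ext
    simp [Finset.sum_apply]
  rw [h3, hgram] at h2
  push_cast at h2
  linarith

variable [Nonempty Ω]

/-- A sum of Haar functions with a large square function is large somewhere. -/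
theorem exists_sqrt_le_sum {ι : Type*} [Fintype ι] [LinearOrder ι] {θ : ι → Equiv.Perm Ω}
    {G : ι → Ω → ℝ} (hG : ∀ i, IsHaar θ i (G i)) (hp : 12 ≤ p) (hN : 0 < N)
    (h : ExceptProb (Real.exp (-(p / 6)))
      (fun ω => N / 2 ≤ ∑ i, G i ω ^ 2 ∧ ∀ i, p * G i ω ^ 2 ≤ N)) :
    ∃ ω, √(p * N) / 12 ≤ ∑ i, G i ω := by
  by_contra! hcon
  have hp0 : 0 < p := by linarith
  -- With this `r`, a sum below `√(p * N) / 12` has exponent at most `p / 12`, a square function of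
  -- at least `N / 2` yields a decay `exp (-p / 6)`, and `p * G i ω ^ 2 ≤ N` puts `r * G i ω` in the
  -- range of `inv_cosh_le`.
  set r : ℝ := √(p / N) with hr
  have hr0 : 0 < r := Real.sqrt_pos.2 (by positivity)
  have hr2 : r ^ 2 = p / N := Real.sq_sqrt (by positivity)
  have hrp : r * √(p * N) = p := by
    rw [hr, ← Real.sqrt_mul (by positivity), show p / N * (p * N) = p ^ 2 by field_simp,
      Real.sqrt_sq hp0.le]
  have h1 := sum_exp_div_cosh_eq (fun i => (hG i).const_mul r) Finset.univ
  have h2 : ∀ ω, ∏ i, (Real.exp (r * G i ω) / Real.cosh (r * G i ω)) ≤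
      Real.exp (p / 12) * ∏ i, (Real.cosh (r * G i ω))⁻¹ := fun ω => by
    simp_rw [div_eq_mul_inv]
    rw [Finset.prod_mul_distrib, ← Real.exp_sum, ← Finset.mul_sum]
    refine mul_le_mul_of_nonneg_right (Real.exp_le_exp.2 ?_)
      (Finset.prod_nonneg fun i _ => inv_nonneg.2 (Real.cosh_pos _).le)
    calc r * ∑ i, G i ω ≤ r * (√(p * N) / 12) := by gcongr; exact (hcon ω).le
      _ = p / 12 := by rw [← mul_div_assoc, hrp]
  have h3 : ∑ ω, ∏ i, (Real.cosh (r * G i ω))⁻¹ ≤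
      (Real.exp (-(p / 6)) + Real.exp (-(p / 6))) * Fintype.card Ω := by
    refine h.sum_le (Real.exp_pos _).le (fun ω => Finset.prod_le_one
      (fun i _ => inv_nonneg.2 (Real.cosh_pos _).le) fun i _ => inv_cosh_le_one _) fun ω hω => ?_
    have h4 : ∀ i, (Real.cosh (r * G i ω))⁻¹ ≤ Real.exp (-((r * G i ω) ^ 2 / 3)) := fun i => by
      refine inv_cosh_le ?_
      rw [mul_pow, hr2, div_mul_eq_mul_div, div_le_one hN]
      exact hω.2 i
    refine (Finset.prod_le_prod (fun i _ => inv_nonneg.2 (Real.cosh_pos _).le)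
      fun i _ => h4 i).trans ?_
    rw [← Real.exp_sum]
    refine Real.exp_le_exp.2 ?_
    rw [Finset.sum_neg_distrib, ← Finset.sum_div, neg_le_neg_iff]
    simp_rw [mul_pow]
    rw [← Finset.mul_sum, hr2]
    have h5 : p / N * (N / 2) ≤ p / N * ∑ i, G i ω ^ 2 :=
      mul_le_mul_of_nonneg_left hω.1 (by positivity)
    have h6 : p / N * (N / 2) = p / 2 := by field_simp
    linarith
  have hcard : (0 : ℝ) < Fintype.card Ω := by exact_mod_cast Fintype.card_pos
  have h4 : (Fintype.card Ω : ℝ) ≤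
      Real.exp (p / 12) * ((Real.exp (-(p / 6)) + Real.exp (-(p / 6))) * Fintype.card Ω) := by
    rw [← h1]
    refine (Finset.sum_le_sum fun ω _ => h2 ω).trans ?_
    rw [← Finset.mul_sum, h1]
    exact mul_le_mul_of_nonneg_left h3 (Real.exp_pos _).le
  have h5 : Real.exp (p / 12) * (Real.exp (-(p / 6)) + Real.exp (-(p / 6))) =
      2 * Real.exp (-(p / 12)) := by
    rw [mul_add, ← Real.exp_add]
    ring_nf
  -- Here `12 ≤ p` enters, through `2 < exp 1`.
  have h6 : 2 * Real.exp (-(p / 12)) < 1 := by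
    have h7 : Real.exp 1 ≤ Real.exp (p / 12) := Real.exp_le_exp.2 (by linarith)
    have h8 := Real.exp_one_gt_d9
    rw [Real.exp_neg, ← div_eq_mul_inv, div_lt_one (Real.exp_pos _)]
    linarith
  rw [← mul_assoc, h5] at h4
  nlinarith

theorem IsHaarFamily.exists_sqrt_le_sum (h : IsHaarFamily n σ τ (fun m : Fin (n + 1) => (m : ℕ)) F)
    (h₀ : ∀ (m : Fin (n + 1)) ρ, IsHaar τ₀ (m : ℕ) (F m ρ)) (hJ : 0 < J) (hnJ : n + 1 ≤ 2 ^ J) (hp : 12 ≤ p)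
    (hN : 0 < N) (hsq : ∀ ω, ∑ a, ∑ ρ, F a ρ ω ^ 2 = N)
    (hthr : 2 * p * ((16 * p * (n + 1)) ^ e * (2 * p * √(n + 1))) * J ^ 2 * (4 * (e + 1)) ^ 2 ≤ N)
    (hpN : p * (16 * p * (n + 1)) ^ e ≤ N)
    (hexp : (e * ((e + 1) * ((n : ℝ) + 1) ^ (e + 1) + J) + e * (n + 1) ^ (e + 1)) ≤
      Real.exp (5 / 6 * p)) :
    ∃ ω, √(p * N) / 12 ≤ ∑ m, ∑ ρ, F m ρ ω := by
  have hG : ∀ m : Fin (n + 1), IsHaar (fun m : Fin (n + 1) => τ₀ m) m (fun ω => ∑ ρ, F m ρ ω) :=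
    fun m => ⟨fun ω => (IsHaar.sum _ fun ρ _ => h₀ m ρ).odd ω,
      fun l hl ω => (IsHaar.sum _ fun ρ _ => h₀ m ρ).invariant l hl ω⟩
  refine _root_.exists_sqrt_le_sum hG hp hN ?_
  -- With this `δ` the total loss `2 * e * δ` is at most `1 / 2`.
  have hδ : (0 : ℝ) < 1 / (4 * (e + 1)) := by positivity
  have he : (0 : ℝ) ≤ e := Nat.cast_nonneg e
  have hδ1 : 1 / (4 * ((e : ℝ) + 1)) ≤ 1 := (div_le_one (by positivity)).2 (by linarith)
  have h1 := IsHaarFamily.exceptProb_sq_sum_ge hJ hnJ (show 1 ≤ p by linarith) hδ hδ1 hN.le e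
    (Y := 1) h one_pos (fun s => ?_) (by simp) hsq ?_
  · have h2 := ExceptProb.forall_fintype fun m : Fin (n + 1) =>
      h.exceptProb_sq_le (show 1 ≤ p by linarith) m
    refine (h1.and h2).mono ?_ fun ω hω => ⟨?_, fun m => ?_⟩
    · rw [Fintype.card_fin]
      push_cast
      calc _ = (e * ((e + 1) * ((n : ℝ) + 1) ^ (e + 1) + J) + e * (n + 1) ^ (e + 1)) *
            Real.exp (-p) := by ring
        _ ≤ Real.exp (5 / 6 * p) * Real.exp (-p) :=
            mul_le_mul_of_nonneg_right hexp (Real.exp_pos _).le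
        _ = _ := by rw [← Real.exp_add]; ring_nf
    · refine le_trans ?_ hω.1
      have h3 : 2 * (e : ℝ) * (1 / (4 * (e + 1))) ≤ 1 / 2 := by
        rw [mul_one_div, div_le_div_iff₀ (by positivity) (by positivity)]
        linarith
      nlinarith
    · exact (mul_le_mul_of_nonneg_left (hω.2 m) (by linarith)).trans hpN
  · have : ({a : Fin (n + 1) | (a : ℕ) = s} : Set (Fin (n + 1))).ncard ≤ 1 := by
      rw [Set.ncard_le_one_iff]
      intro a b ha hb
      exact Fin.ext ((show (a : ℕ) = s from ha).trans (show (b : ℕ) = s from hb).symm)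
    exact_mod_cast this
  · rw [mul_one, div_le_iff₀ hδ, one_div_mul_eq_div, div_mul_eq_mul_div, mul_one_div,
      div_div, le_div_iff₀ (by positivity)]
    linarith

end Lower

/-! ### Counting levels and choosing parameters. -/

/-- The simplex of admissible levels contains the cube of side `n / (e + 1)`, rounded down. -/
theorem pow_le_card_levels (n e : ℕ) : (((n : ℝ) + 1) / (e + 1)) ^ (e + 1) ≤
    ((Finset.univ.filter fun q : Fin (n + 1) × (Fin e → Fin (n + 1)) =>
      (q.1 : ℕ) + ∑ i, (q.2 i : ℕ) ≤ n).card : ℝ) := by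
  set k := n / (e + 1) with hk
  have hkn : (e + 1) * k ≤ n := Nat.mul_div_le n (e + 1)
  have hk1 : k + 1 ≤ n + 1 := by
    have : k ≤ n := Nat.div_le_self _ _
    omega
  have h1 : n + 1 ≤ (k + 1) * (e + 1) := by
    rw [mul_comm]
    exact Nat.lt_mul_div_succ n (Nat.succ_pos e)
  have h2 : ((n : ℝ) + 1) / (e + 1) ≤ k + 1 := by
    rw [div_le_iff₀ (by positivity)]
    exact_mod_cast h1
  have h3 : (k + 1) ^ (e + 1) ≤ (Finset.univ.filter fun q : Fin (n + 1) × (Fin e → Fin (n + 1)) =>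
      (q.1 : ℕ) + ∑ i, (q.2 i : ℕ) ≤ n).card := by
    have h4 : Fintype.card (Fin (k + 1) × (Fin e → Fin (k + 1))) = (k + 1) ^ (e + 1) := by
      simp [pow_succ, mul_comm]
    rw [← h4, ← Finset.card_univ]
    refine Finset.card_le_card_of_injOn
      (fun q => (Fin.castLE hk1 q.1, fun i => Fin.castLE hk1 (q.2 i))) ?_ ?_
    · intro q _
      simp only [Finset.coe_filter, Finset.mem_univ, true_and, Set.mem_ofPred_eq, Fin.val_castLE]
      have h5 : ∑ i, (q.2 i : ℕ) ≤ e * k := by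
        refine (Finset.sum_le_card_nsmul _ _ k fun i _ => Nat.lt_succ_iff.1 (q.2 i).isLt).trans ?_
        simp
      have h6 := q.1.isLt
      have h7 : (e + 1) * k = e * k + k := by ring
      omega
    · rintro ⟨a, b⟩ _ ⟨a', b'⟩ _ hq
      simp only [Prod.mk.injEq, Fin.castLE_inj] at hq
      exact Prod.ext hq.1 (funext fun i => Fin.castLE_injective hk1 (congrFun hq.2 i))
  calc _ ≤ ((k : ℝ) + 1) ^ (e + 1) := by gcongr
    _ ≤ _ := by exact_mod_cast h3

theorem eventually_pow_le_exp (C : ℝ) {b : ℝ} (hb : 0 < b) (k : ℕ) :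
    ∀ᶠ t : ℝ in Filter.atTop, C * t ^ k ≤ Real.exp (b * t) := by
  have h := (isLittleO_pow_exp_pos_mul_atTop k hb).const_mul_left C
  filter_upwards [h.bound one_pos] with t ht
  rw [one_mul, Real.norm_of_nonneg (Real.exp_pos _).le] at ht
  exact (le_abs_self _).trans ht

/-- The numerical conditions on the parameters, with `n + 1 = t ^ (4 (e + 2))` and `p = t`. -/
theorem eventually_parameters {e : ℕ} (he : 1 ≤ e) {c : ℝ} (hc : 0 < c) :
    ∀ᶠ t : ℝ in Filter.atTop, 12 ≤ t ∧ t ^ (4 * (e + 2)) ≤ 2 ^ ⌈t⌉₊ ∧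
      2 * t * ((16 * t * t ^ (4 * (e + 2))) ^ e * (2 * t * t ^ (2 * (e + 2)))) * (⌈t⌉₊ : ℝ) ^ 2 *
        (4 * (e + 1)) ^ 2 ≤ c * (t ^ (4 * (e + 2))) ^ (e + 1) ∧
      t * (16 * t * t ^ (4 * (e + 2))) ^ e ≤ c * (t ^ (4 * (e + 2))) ^ (e + 1) ∧
      e * ((e + 1) * (t ^ (4 * (e + 2))) ^ (e + 1) + ⌈t⌉₊) + e * (t ^ (4 * (e + 2))) ^ (e + 1) ≤
        Real.exp (5 / 6 * t) := by
  have h2 : (0 : ℝ) < Real.log 2 := Real.log_pos one_lt_two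
  filter_upwards [Filter.eventually_ge_atTop 12, eventually_pow_le_exp 1 h2 (4 * (e + 2)),
    Filter.eventually_ge_atTop (4 * 16 ^ e * 4 * (4 * (e + 1)) ^ 2 / c),
    Filter.eventually_ge_atTop (16 ^ e / c),
    eventually_pow_le_exp ((e : ℝ) * ((e + 1) + 1) + e) (show (0 : ℝ) < 5 / 6 by norm_num)
      (4 * (e + 2) * (e + 1))] with t ht12 hexp2 hK hK' hexp
  have ht0 : 0 < t := by linarith
  have ht1 : 1 ≤ t := by linarith
  have hceil : (⌈t⌉₊ : ℝ) ≤ 2 * t := by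
    have := (Nat.ceil_lt_add_one ht0.le).le
    linarith
  rw [div_le_iff₀ hc] at hK hK'
  refine ⟨ht12, ?_, ?_, ?_, ?_⟩
  · rw [one_mul] at hexp2
    refine hexp2.trans ?_
    rw [← Real.rpow_natCast, Real.rpow_def_of_pos two_pos]
    exact Real.exp_le_exp.2 (mul_le_mul_of_nonneg_left (Nat.le_ceil t) h2.le)
  · calc _ ≤ 2 * t * ((16 * t * t ^ (4 * (e + 2))) ^ e * (2 * t * t ^ (2 * (e + 2)))) *
          (2 * t) ^ 2 * (4 * (e + 1)) ^ 2 := by gcongr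
      _ = (4 * 16 ^ e * 4 * (4 * (e + 1)) ^ 2) *
          t ^ (4 * (e + 2) * e + e + 2 * (e + 2) + 4) := by
          simp only [mul_pow, ← pow_mul, pow_add]
          ring
      _ ≤ (t * c) * t ^ (4 * (e + 2) * e + e + 2 * (e + 2) + 4) := by gcongr
      _ = c * t ^ (4 * (e + 2) * e + e + 2 * (e + 2) + 4 + 1) := by ring
      -- The exponents compare as `3 * e + 9 ≤ 4 * e + 8`, which is where `1 ≤ e`, that is `d ≥ 3`,
      -- is needed. One power of `t` has absorbed the constants.
      _ ≤ c * t ^ (4 * (e + 2) * (e + 1)) := by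
          gcongr
          nlinarith
      _ = _ := by rw [pow_mul t (4 * (e + 2)) (e + 1)]
  · calc _ = 16 ^ e * t ^ (4 * (e + 2) * e + e + 1) := by
          simp only [mul_pow, ← pow_mul, pow_add]
          ring
      _ ≤ (t * c) * t ^ (4 * (e + 2) * e + e + 1) := by gcongr
      _ = c * t ^ (4 * (e + 2) * e + e + 1 + 1) := by ring
      _ ≤ c * t ^ (4 * (e + 2) * (e + 1)) := by
          gcongr
          nlinarith
      _ = _ := by rw [pow_mul t (4 * (e + 2)) (e + 1)]
  · rw [← pow_mul]
    refine le_trans ?_ hexp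
    have h3 : (⌈t⌉₊ : ℝ) ≤ t ^ (4 * (e + 2) * (e + 1)) := by
      calc (⌈t⌉₊ : ℝ) ≤ 2 * t := hceil
        _ ≤ t ^ 2 := by nlinarith
        _ ≤ _ := pow_le_pow_right₀ ht1 (by nlinarith)
    have h4 := mul_le_mul_of_nonneg_left h3 (Nat.cast_nonneg (α := ℝ) e)
    linarith

/-! ### The inequality for families of signs. -/

section Main

variable {Ω : Type} [Fintype Ω] [Nonempty Ω] {n e : ℕ} {σ τ₀ : ℕ → Equiv.Perm Ω}
  {τ : Fin e → ℕ → Equiv.Perm Ω} {F : Fin (n + 1) → (Fin e → Fin (n + 1)) → Ω → ℝ}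

/-- Flipping the digit of level `n` in the first coordinate affects only `m = n`, where `ρ = 0` is
the sole admissible index. The sum therefore changes by exactly `2` in absolute value. This settles
small `n`. -/
theorem IsHaarFamily.exists_one_le_abs_sum
    (h : IsHaarFamily n σ τ (fun m : Fin (n + 1) => (m : ℕ)) F)
    (h₀ : ∀ (m : Fin (n + 1)) ρ, IsHaar τ₀ (m : ℕ) (F m ρ))
    (hF : ∀ (m : Fin (n + 1)) ρ, (m : ℕ) + ∑ i, (ρ i : ℕ) ≤ n → ∀ ω, F m ρ ω ^ 2 = 1) :
    ∃ ω, 1 ≤ |∑ m, ∑ ρ, F m ρ ω| := by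
  obtain ⟨ω⟩ := (inferInstance : Nonempty Ω)
  have hlast : ∀ ω, ∑ ρ, F (Fin.last n) ρ ω = F (Fin.last n) 0 ω := fun ω => by
    refine Finset.sum_eq_single 0 (fun ρ _ hρ => ?_) (fun h => absurd (Finset.mem_univ _) h)
    obtain ⟨i, hi⟩ := Function.ne_iff.1 hρ
    have h1 : 0 < (ρ i : ℕ) := Nat.pos_of_ne_zero fun h0 => hi (Fin.ext h0)
    have h2 : (ρ i : ℕ) ≤ ∑ i, (ρ i : ℕ) :=
      Finset.single_le_sum (f := fun i => (ρ i : ℕ)) (fun _ _ => Nat.zero_le _) (Finset.mem_univ i)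
    rw [h.eq_zero (Fin.last n) ρ (by simp only [Fin.val_last]; omega)]
    rfl
  have hdiff : ∑ m, ∑ ρ, F m ρ ω - ∑ m, ∑ ρ, F m ρ (τ₀ n ω) = 2 * F (Fin.last n) 0 ω := by
    rw [Fin.sum_univ_castSucc, Fin.sum_univ_castSucc, hlast, hlast]
    have h1 : ∀ m : Fin n, ∑ ρ, F m.castSucc ρ (τ₀ n ω) = ∑ ρ, F m.castSucc ρ ω := fun m =>
      Finset.sum_congr rfl fun ρ _ => (h₀ m.castSucc ρ).invariant n (by simp) ω
    have h2 := (h₀ (Fin.last n) 0).odd ω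
    rw [Fin.val_last] at h2
    simp_rw [h1]
    rw [h2]
    ring
  have h1 : |F (Fin.last n) 0 ω| = 1 := by
    have := hF (Fin.last n) 0 (by simp) ω
    rw [← sq_abs] at this
    exact (pow_eq_one_iff_of_nonneg (abs_nonneg _) two_ne_zero).1 this
  by_contra! hcon
  have h2 := hcon ω
  have h3 := hcon (τ₀ n ω)
  have h4 : |2 * F (Fin.last n) 0 ω| < 2 := by
    rw [← hdiff]
    exact (abs_sub _ _).trans_lt (by linarith)
  rw [abs_mul, h1, abs_two] at h4
  linarith

/-- The signed small ball inequality for families of signs. -/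
theorem exists_const_le_abs_sum {e : ℕ} (he : 1 ≤ e) : ∃ c : ℝ, 0 < c ∧
    ∀ {Ω : Type} [Fintype Ω] [Nonempty Ω] {n : ℕ} {σ τ₀ : ℕ → Equiv.Perm Ω}
      {τ : Fin e → ℕ → Equiv.Perm Ω} {F : Fin (n + 1) → (Fin e → Fin (n + 1)) → Ω → ℝ},
      IsHaarFamily n σ τ (fun m : Fin (n + 1) => (m : ℕ)) F →
      (∀ (m : Fin (n + 1)) ρ, IsHaar τ₀ (m : ℕ) (F m ρ)) →
      (∀ (m : Fin (n + 1)) ρ, (m : ℕ) + ∑ i, (ρ i : ℕ) ≤ n → ∀ ω, F m ρ ω ^ 2 = 1) →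
      ∃ ω, c * ((n : ℝ) + 1) ^ (((e : ℝ) + 1) / 2 + 1 / (8 * (e + 2))) ≤
        |∑ m, ∑ ρ, F m ρ ω| := by
  set b : ℝ := (1 / (e + 1)) ^ (e + 1) with hb
  have hb0 : 0 < b := by positivity
  set κ : ℝ := ((e : ℝ) + 1) / 2 + 1 / (8 * (e + 2)) with hκ
  have hκ0 : 0 < κ := by positivity
  obtain ⟨T, hT⟩ := Filter.eventually_atTop.1 (eventually_parameters he hb0)
  set T' := max T 1 with hT'
  have hT'0 : 0 < T' := lt_max_of_lt_right one_pos
  -- For `t < T'` the dimension-free bound `1` suffices, and `c₂` is chosen to scale down to it.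
  set c₂ : ℝ := (T' ^ (4 * (e + 2))) ^ (-κ) with hc₂
  have hc₂0 : 0 < c₂ := by positivity
  refine ⟨min (√b / 12) c₂, lt_min (by positivity) hc₂0, ?_⟩
  intro Ω _ _ n σ τ₀ τ F h h₀ hF
  have hL : (0 : ℝ) < n + 1 := by positivity
  set t : ℝ := ((n : ℝ) + 1) ^ (1 / (4 * ((e : ℝ) + 2))) with ht
  have ht0 : 0 < t := by positivity
  have htL : t ^ (4 * (e + 2)) = (n : ℝ) + 1 := by
    rw [ht, ← Real.rpow_natCast, ← Real.rpow_mul hL.le]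
    push_cast
    rw [one_div_mul_cancel (by positivity), Real.rpow_one]
  rcases lt_or_ge t T' with htT | htT
  · obtain ⟨ω, hω⟩ := h.exists_one_le_abs_sum h₀ hF
    refine ⟨ω, le_trans ?_ hω⟩
    calc min (√b / 12) c₂ * ((n : ℝ) + 1) ^ κ ≤ c₂ * (T' ^ (4 * (e + 2))) ^ κ := by
          rw [← htL]
          gcongr
          exact min_le_right _ _
      _ = 1 := by
          rw [hc₂, ← Real.rpow_add (by positivity), neg_add_cancel, Real.rpow_zero]
  · obtain ⟨hp, h1, h2, h3, h4⟩ := hT t ((le_max_left _ _).trans htT)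
    have hsqrt : t ^ (2 * (e + 2)) = √((n : ℝ) + 1) := by
      rw [← htL, show 4 * (e + 2) = 2 * (e + 2) * 2 by ring, pow_mul t (2 * (e + 2)) 2,
        Real.sqrt_sq (by positivity)]
    rw [htL] at h1 h2 h3 h4
    rw [hsqrt] at h2
    set N : ℝ := ((Finset.univ.filter fun q : Fin (n + 1) × (Fin e → Fin (n + 1)) =>
      (q.1 : ℕ) + ∑ i, (q.2 i : ℕ) ≤ n).card : ℝ) with hN
    have hbN : b * ((n : ℝ) + 1) ^ (e + 1) ≤ N := by
      refine le_trans (le_of_eq ?_) (pow_le_card_levels n e)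
      rw [hb, ← mul_pow, one_div_mul_eq_div]
    have hsq : ∀ ω, ∑ a, ∑ ρ, F a ρ ω ^ 2 = N := fun ω => by
      rw [← Fintype.sum_prod_type' (f := fun a ρ => F a ρ ω ^ 2), hN, Finset.card_filter]
      push_cast
      refine Finset.sum_congr rfl fun q _ => ?_
      split_ifs with hq
      · exact hF q.1 q.2 hq ω
      · rw [h.eq_zero q.1 q.2 (not_le.1 hq)]
        simp
    have hJ : 0 < ⌈t⌉₊ := Nat.ceil_pos.2 ht0
    obtain ⟨ω, hω⟩ := h.exists_sqrt_le_sum h₀ hJ (by exact_mod_cast h1) hp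
      (lt_of_lt_of_le (by positivity) hbN) hsq (h2.trans hbN) (h3.trans hbN) h4
    refine ⟨ω, le_trans (le_trans ?_ hω) (le_abs_self _)⟩
    -- The factor `t` under the root, a power `1 / (4 * (e + 2))` of `n + 1`, gives the gain `1 / (8
    -- * (e + 2))`.
    have h5 : ((n : ℝ) + 1) ^ κ = √(t * ((n : ℝ) + 1) ^ (e + 1)) := by
      rw [Real.sqrt_eq_rpow, ht, ← Real.rpow_natCast, ← Real.rpow_add hL, ← Real.rpow_mul hL.le, hκ]
      congr 1
      push_cast
      field_simp
      ring
    calc min (√b / 12) c₂ * ((n : ℝ) + 1) ^ κ ≤ √b / 12 * ((n : ℝ) + 1) ^ κ := by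
          gcongr
          exact min_le_left _ _
      _ = √(t * (b * ((n : ℝ) + 1) ^ (e + 1))) / 12 := by
          rw [h5, div_mul_eq_mul_div, ← Real.sqrt_mul hb0.le]
          ring_nf
      _ ≤ √(t * N) / 12 := by gcongr

end Main

/-! ### Binary digits and one-dimensional Haar functions. -/

section Digits

/-- The integer with binary digits the first `k` digits of `b`. -/
def digitPrefix {L : ℕ} (b : Fin L → Bool) : ℕ → ℕ
  | 0 => 0
  | k + 1 => 2 * digitPrefix b k + if h : k < L then (b ⟨k, h⟩).toNat else 0

/-- The sign attached to the `k`-th binary digit of `b`. -/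
def digitSign {L : ℕ} (b : Fin L → Bool) (k : ℕ) : ℝ :=
  if h : k < L then (if b ⟨k, h⟩ then 1 else -1) else 1

/-- The permutation of the digit strings that flips the `l`-th digit of the `c`-th coordinate. -/
def flipDigit {d : ℕ} (L : ℕ) (c : Fin d) (l : ℕ) : Equiv.Perm (Fin d → Fin L → Bool) :=
  Function.Involutive.toPerm (fun ω i j => if i = c ∧ (j : ℕ) = l then !ω i j else ω i j)
    (fun ω => by ext i j; by_cases h : i = c ∧ (j : ℕ) = l <;> simp [h])

theorem flipDigit_apply {d L : ℕ} (c : Fin d) (l : ℕ) (ω : Fin d → Fin L → Bool) (i : Fin d)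
    (j : Fin L) : flipDigit L c l ω i j = if i = c ∧ (j : ℕ) = l then !ω i j else ω i j := rfl

theorem flipDigit_apply_of_ne {d L : ℕ} {c i : Fin d} (h : i ≠ c) (l : ℕ)
    (ω : Fin d → Fin L → Bool) : flipDigit L c l ω i = ω i := by
  ext j; simp [flipDigit_apply, h]

theorem digitPrefix_congr {L : ℕ} {b b' : Fin L → Bool} {k : ℕ}
    (h : ∀ j : Fin L, (j : ℕ) < k → b j = b' j) : digitPrefix b k = digitPrefix b' k := by
  induction k with
  | zero => rfl
  | succ k ih =>
    rw [digitPrefix, digitPrefix, ih fun j hj => h j (by omega)]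
    congr 1
    split_ifs with hk
    · rw [h ⟨k, hk⟩ (Nat.lt_succ_self k)]
    · rfl

theorem digitPrefix_flipDigit {d L : ℕ} (c : Fin d) {l k : ℕ} (h : k ≤ l)
    (ω : Fin d → Fin L → Bool) (i : Fin d) :
    digitPrefix (flipDigit L c l ω i) k = digitPrefix (ω i) k :=
  digitPrefix_congr fun j hj => by rw [flipDigit_apply, if_neg (by omega)]

theorem digitSign_flipDigit_of_lt {d L : ℕ} (c : Fin d) {l k : ℕ} (h : k < l)
    (ω : Fin d → Fin L → Bool) (i : Fin d) :
    digitSign (flipDigit L c l ω i) k = digitSign (ω i) k := by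
  unfold digitSign
  split_ifs with hk h1 h2 h2 <;> simp_all [flipDigit_apply, h.ne]

theorem digitSign_flipDigit_self {d L : ℕ} (c : Fin d) {k : ℕ} (hk : k < L)
    (ω : Fin d → Fin L → Bool) :
    digitSign (flipDigit L c k ω c) k = -digitSign (ω c) k := by
  unfold digitSign
  simp only [hk, dif_pos, flipDigit_apply, and_self, if_true]
  cases ω c ⟨k, hk⟩ <;> simp

theorem digitPrefix_lt {L : ℕ} (b : Fin L → Bool) (k : ℕ) : digitPrefix b k < 2 ^ k := by
  induction k with
  | zero => simp [digitPrefix]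
  | succ k ih =>
    have h : (if h : k < L then (b ⟨k, h⟩).toNat else 0) ≤ 1 := by
      split_ifs
      · exact Bool.toNat_le _
      · exact Nat.zero_le _
    rw [digitPrefix, pow_succ]
    omega

/-- The numbers whose binary expansion starts with `b`. -/
def digitInterval {L : ℕ} (b : Fin L → Bool) : Set ℝ :=
  Set.Ico ((digitPrefix b L : ℝ) / 2 ^ L) ((digitPrefix b L + 1) / 2 ^ L)

theorem mem_Ico_digitPrefix {L : ℕ} {b : Fin L → Bool} {x : ℝ} (hx : x ∈ digitInterval b)
    {k : ℕ} (hk : k ≤ L) :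
    x ∈ Set.Ico ((digitPrefix b k : ℝ) / 2 ^ k) ((digitPrefix b k + 1) / 2 ^ k) := by
  induction hk using Nat.decreasingInduction with
  | self => exact hx
  | of_succ k hk ih =>
    obtain ⟨h1, h2⟩ := ih
    rw [div_le_iff₀ (by positivity), pow_succ] at h1
    rw [lt_div_iff₀ (by positivity), pow_succ] at h2
    have h3 : (digitPrefix b (k + 1) : ℝ) = 2 * digitPrefix b k + (b ⟨k, hk⟩).toNat := by
      rw [digitPrefix, dif_pos hk]; push_cast; rfl
    have h4 : ((b ⟨k, hk⟩).toNat : ℝ) ≤ 1 := by exact_mod_cast Bool.toNat_le _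
    have h5 : (0 : ℝ) ≤ (b ⟨k, hk⟩).toNat := Nat.cast_nonneg _
    rw [h3] at h1 h2
    constructor
    · rw [div_le_iff₀ (by positivity)]; linarith
    · rw [lt_div_iff₀ (by positivity)]; linarith

theorem DyadicInterval.length_mk_neg (k : ℕ) (j : ℤ) :
    (DyadicInterval.mk (-(k : ℤ)) j).length = 1 / 2 ^ k := by
  simp [DyadicInterval.length]

theorem DyadicInterval.haar_digitPrefix {L : ℕ} {b : Fin L → Bool} {x : ℝ}
    (hx : x ∈ digitInterval b) {k : ℕ} (hk : k < L) :
    (DyadicInterval.mk (-(k : ℤ)) (digitPrefix b k)).haar x = digitSign b k := by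
  have h1 := mem_Ico_digitPrefix hx hk
  have h3 : digitPrefix b (k + 1) = 2 * digitPrefix b k + (b ⟨k, hk⟩).toNat := by
    rw [digitPrefix, dif_pos hk]
  have h2 : (0 : ℝ) < 2 ^ k := by positivity
  have hl : (DyadicInterval.mk (-(k : ℤ)) (digitPrefix b k)).left = digitPrefix b k / 2 ^ k := by
    rw [DyadicInterval.left, DyadicInterval.length_mk_neg]
    push_cast
    ring
  obtain ⟨h1, h1'⟩ := h1
  rw [div_le_iff₀ (by positivity), pow_succ, h3] at h1
  rw [lt_div_iff₀ (by positivity), pow_succ, h3] at h1'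
  unfold DyadicInterval.haar DyadicInterval.leftHalf DyadicInterval.rightHalf digitSign
  rw [hl, DyadicInterval.length_mk_neg, dif_pos hk]
  have e1 : (digitPrefix b k : ℝ) / 2 ^ k + 1 / 2 ^ k / 2 =
      (2 * digitPrefix b k + 1) / (2 ^ k * 2) := by
    field_simp
  have e2 : (digitPrefix b k : ℝ) / 2 ^ k + 1 / 2 ^ k =
      (2 * digitPrefix b k + 2) / (2 ^ k * 2) := by
    field_simp
  have e3 : (digitPrefix b k : ℝ) / 2 ^ k = 2 * digitPrefix b k / (2 ^ k * 2) := by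
    field_simp
  rw [e1, e2, e3]
  rcases hb : b ⟨k, hk⟩ with _ | _
  · rw [hb] at h1 h1'
    simp only [Bool.toNat_false, add_zero, Nat.cast_mul, Nat.cast_ofNat] at h1 h1'
    rw [Set.indicator_of_mem, Set.indicator_of_notMem]
    · simp
    · rintro ⟨h4, _⟩
      rw [div_le_iff₀ (by positivity)] at h4
      linarith
    · exact ⟨by rw [div_le_iff₀ (by positivity)]; linarith,
        by rw [lt_div_iff₀ (by positivity)]; linarith⟩
  · rw [hb] at h1 h1'
    simp only [Bool.toNat_true, Nat.cast_add, Nat.cast_mul, Nat.cast_ofNat, Nat.cast_one] at h1 h1'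
    rw [Set.indicator_of_notMem, Set.indicator_of_mem]
    · simp
    · exact ⟨by rw [div_le_iff₀ (by positivity)]; linarith,
        by rw [lt_div_iff₀ (by positivity)]; linarith⟩
    · rintro ⟨_, h4⟩
      rw [lt_div_iff₀ (by positivity)] at h4
      linarith

theorem DyadicInterval.haar_eq_zero {I : DyadicInterval} {x : ℝ} (hx : x ∉ I.toSet) :
    I.haar x = 0 := by
  have h := I.length_pos
  unfold DyadicInterval.haar
  rw [Set.indicator_of_notMem, Set.indicator_of_notMem]
  · simp
  · exact fun h' => hx ⟨by linarith [h'.1], h'.2⟩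
  · exact fun h' => hx ⟨h'.1, by linarith [h'.2]⟩

theorem DyadicInterval.haar_eq_zero_of_ne {L : ℕ} {b : Fin L → Bool} {x : ℝ}
    (hx : x ∈ digitInterval b) {k : ℕ} (hk : k ≤ L) {j : ℤ} (hj : j ≠ digitPrefix b k) :
    (DyadicInterval.mk (-(k : ℤ)) j).haar x = 0 := by
  refine DyadicInterval.haar_eq_zero fun h => hj ?_
  obtain ⟨h1, h2⟩ := mem_Ico_digitPrefix hx hk
  have hp : (0 : ℝ) < 2 ^ k := by positivity
  obtain ⟨h3, h4⟩ := h
  rw [DyadicInterval.left, DyadicInterval.length_mk_neg] at h3 h4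
  rw [div_le_iff₀ hp] at h1
  rw [lt_div_iff₀ hp] at h2
  rw [mul_one_div, div_le_iff₀ hp] at h3
  rw [mul_one_div, ← add_div, lt_div_iff₀ hp] at h4
  have h5 : (j : ℝ) < digitPrefix b k + 1 := by linarith
  have h6 : (digitPrefix b k : ℝ) < j + 1 := by linarith
  have h7 : j < digitPrefix b k + 1 := by exact_mod_cast h5
  have h8 : (digitPrefix b k : ℤ) < j + 1 := by exact_mod_cast h6
  omega

end Digits

/-! ### Haar functions of rectangles on digit cubes. -/

section Rects

variable {d n : ℕ}

theorem DyadicRect.volume_toSet (R : DyadicRect d) :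
    volume R.toSet = ENNReal.ofReal (∏ i, (R i).length) := by
  rw [DyadicRect.toSet, volume_pi_pi, ENNReal.ofReal_prod_of_nonneg
    fun i _ => (R i).length_pos.le]
  exact Finset.prod_congr rfl fun i _ => by simp [DyadicInterval.toSet]

theorem inv_two_pow_eq_ofReal (n : ℕ) : (2⁻¹ : ℝ≥0∞) ^ n = ENNReal.ofReal ((2 : ℝ)⁻¹ ^ n) := by
  rw [ENNReal.ofReal_pow (by norm_num), ENNReal.ofReal_inv_of_pos two_pos, ENNReal.ofReal_ofNat]

theorem prod_length_eq_zpow (R : DyadicRect d) :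
    ∏ i, (R i).length = (2 : ℝ) ^ (∑ i, (R i).scale) := by
  have h : ∀ s : Finset (Fin d), ∏ i ∈ s, (R i).length = (2 : ℝ) ^ (∑ i ∈ s, (R i).scale) := by
    intro s
    induction s using Finset.cons_induction with
    | empty => simp
    | cons a s ha ih => rw [Finset.prod_cons, Finset.sum_cons, zpow_add₀ two_ne_zero, ih]; rfl
  exact h Finset.univ

theorem scale_of_mem_hyperbolicRects {R : DyadicRect d} (hR : R ∈ hyperbolicRects d n) :
    (∀ i, (R i).scale ≤ 0) ∧ ∑ i, (R i).scale = -(n : ℤ) := by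
  obtain ⟨hsub, hvol⟩ := hR
  constructor
  · intro i
    by_contra! hcon
    have hlen : 2 ≤ (R i).length := by
      calc (2 : ℝ) = 2 ^ (1 : ℤ) := by norm_num
        _ ≤ _ := zpow_le_zpow_right₀ one_le_two hcon
    have hmem : ∀ y ∈ (R i).toSet, y ∈ Set.Icc (0 : ℝ) 1 := by
      intro y hy
      have hz : (Function.update (fun l => (R l).left) i y) ∈ DyadicRect.toSet R := by
        intro l _
        by_cases hl : l = i
        · subst hl; simpa using hy
        · simp only [Function.update_of_ne hl]
          exact ⟨le_rfl, by linarith [(R l).length_pos]⟩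
      have := hsub hz
      exact ⟨by simpa using this.1 i, by simpa using this.2 i⟩
    have h1 := hmem (R i).left ⟨le_rfl, by linarith⟩
    have h2 := hmem ((R i).left + 3 / 2) ⟨by linarith, by linarith⟩
    linarith [h1.1, h2.2]
  · rw [DyadicRect.volume_toSet, inv_two_pow_eq_ofReal, prod_length_eq_zpow,
      ENNReal.ofReal_eq_ofReal_iff (by positivity) (by positivity), inv_pow, ← zpow_natCast,
      ← zpow_neg] at hvol
    exact zpow_right_injective₀ two_pos (by norm_num) hvol

/-- The dyadic rectangle with side lengths `2 ^ (-r i)` containing the cube of the digits `ω`. -/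
def digitRect {L : ℕ} (r : Fin d → ℕ) (ω : Fin d → Fin L → Bool) : DyadicRect d :=
  fun i => ⟨-(r i : ℤ), digitPrefix (ω i) (r i)⟩

theorem digitRect_mem {L : ℕ} {r : Fin d → ℕ} (hr : ∑ i, r i = n) (ω : Fin d → Fin L → Bool) :
    digitRect r ω ∈ hyperbolicRects d n := by
  constructor
  · intro x hx
    have h : ∀ i, 0 ≤ x i ∧ x i ≤ 1 := fun i => by
      obtain ⟨h1, h2⟩ := hx i (Set.mem_univ i)
      have hp : (0 : ℝ) < 2 ^ r i := by positivity
      have h3 : (digitPrefix (ω i) (r i) : ℝ) + 1 ≤ 2 ^ r i := by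
        exact_mod_cast digitPrefix_lt (ω i) (r i)
      simp only [digitRect, DyadicInterval.left, DyadicInterval.length_mk_neg, Int.cast_natCast,
        mul_one_div] at h1 h2
      rw [← add_div, lt_div_iff₀ hp] at h2
      refine ⟨le_trans (by positivity) h1, ?_⟩
      nlinarith
    exact ⟨fun i => (h i).1, fun i => (h i).2⟩
  · rw [DyadicRect.volume_toSet, inv_two_pow_eq_ofReal, prod_length_eq_zpow]
    congr 1
    simp only [digitRect]
    rw [Finset.sum_neg_distrib, zpow_neg, inv_pow, ← hr]
    rw [← Nat.cast_sum, zpow_natCast]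

/-- The cube of points whose coordinates have binary expansions starting with `ω`. -/
def digitCube {L : ℕ} (ω : Fin d → Fin L → Bool) : Set (Fin d → ℝ) :=
  Set.pi Set.univ fun i => digitInterval (ω i)

/-- The value of `∑ α(R) h_R`, over the rectangles with sides `2 ^ (-r i)`, on a cube. -/
noncomputable def signFunction {L : ℕ} (α : DyadicRect d → ℝ) (r : Fin d → ℕ)
    (ω : Fin d → Fin L → Bool) : ℝ :=
  α (digitRect r ω) * ∏ i, digitSign (ω i) (r i)

/-- For each vector of side lengths a single rectangle contains the cube of `ω`, and every other one
has a side missing it. Levels are at most `n`, so `n + 1` digits determine all Haar signs. -/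
theorem hyperbolicHaarSum_eq_sum_signFunction (α : DyadicRect d → ℝ)
    {ω : Fin d → Fin (n + 1) → Bool} {x : Fin d → ℝ} (hx : x ∈ digitCube ω) :
    hyperbolicHaarSum d n α x =
      ∑ r ∈ Finset.piAntidiag (Finset.univ : Finset (Fin d)) n, signFunction α r ω := by
  have hle : ∀ r ∈ Finset.piAntidiag (Finset.univ : Finset (Fin d)) n, ∀ i, r i < n + 1 := by
    intro r hr i
    have h1 := (Finset.mem_piAntidiag.1 hr).1
    have h2 : r i ≤ ∑ i, r i := Finset.single_le_sum (fun _ _ => Nat.zero_le _) (Finset.mem_univ i)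
    exact Nat.lt_succ_of_le (h2.trans h1.le)
  symm
  refine Finset.sum_of_injOn (fun r => digitRect r ω) ?_ ?_ ?_ ?_
  · intro r _ r' _ h
    ext i
    have := congrArg DyadicInterval.scale (congrFun h i)
    simp only [digitRect] at this
    omega
  · intro r hr
    simp only [Set.Finite.coe_toFinset]
    exact digitRect_mem (Finset.mem_piAntidiag.1 hr).1 ω
  · intro R hR hR'
    rw [Set.Finite.mem_toFinset] at hR
    obtain ⟨hs, hsum⟩ := scale_of_mem_hyperbolicRects hR
    set r : Fin d → ℕ := fun i => (-(R i).scale).toNat with hr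
    have hrs : ∀ i, (R i).scale = -(r i : ℤ) := fun i => by
      have := hs i
      simp only [hr]
      omega
    have hrn : ∑ i, r i = n := by
      have : (∑ i, (r i : ℤ)) = n := by
        rw [← neg_inj, ← hsum, ← Finset.sum_neg_distrib]
        exact Finset.sum_congr rfl fun i _ => (hrs i).symm
      exact_mod_cast this
    have hrmem : r ∈ Finset.piAntidiag (Finset.univ : Finset (Fin d)) n :=
      Finset.mem_piAntidiag.2 ⟨hrn, fun i _ => Finset.mem_univ i⟩
    have hex : ∃ i, (R i).pos ≠ digitPrefix (ω i) (r i) := by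
      by_contra! hcon
      refine hR' ⟨r, hrmem, funext fun i => ?_⟩
      simp only [digitRect, ← hrs, ← hcon]
    obtain ⟨i, hi⟩ := hex
    have h0 : (R i).haar (x i) = 0 := by
      have := DyadicInterval.haar_eq_zero_of_ne (hx i (Set.mem_univ i)) (hle r hrmem i).le hi
      rwa [← hrs] at this
    rw [DyadicRect.haar, Finset.prod_eq_zero (Finset.mem_univ i) h0, mul_zero]
  · intro r hr
    unfold signFunction DyadicRect.haar
    congr 1
    exact Finset.prod_congr rfl fun i _ =>
      (DyadicInterval.haar_digitPrefix (hx i (Set.mem_univ i)) (hle r hr i)).symm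

/-- The rectangle sees only the digits before position `r i` of coordinate `i`, hence so does its
coefficient; digit `r i` itself enters only as the Haar sign. -/
theorem isHaar_signFunction (α : DyadicRect d → ℝ) {r : Fin d → ℕ} {L : ℕ} (i : Fin d)
    (hr : r i < L) : IsHaar (flipDigit L i) (r i) (signFunction α r) := by
  have hrect : ∀ l, r i ≤ l → ∀ ω : Fin d → Fin L → Bool,
      digitRect r (flipDigit L i l ω) = digitRect r ω := by
    intro l hl ω
    ext1 c
    simp only [digitRect]
    by_cases hc : c = i
    · subst hc; rw [digitPrefix_flipDigit c hl]
    · rw [flipDigit_apply_of_ne hc]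
  have hprod : ∀ l (ω : Fin d → Fin L → Bool),
      ∏ c ∈ Finset.univ.erase i, digitSign (flipDigit L i l ω c) (r c) =
        ∏ c ∈ Finset.univ.erase i, digitSign (ω c) (r c) := fun l ω =>
    Finset.prod_congr rfl fun c hc => by rw [flipDigit_apply_of_ne (Finset.ne_of_mem_erase hc)]
  refine ⟨fun ω => ?_, fun l hl ω => ?_⟩ <;>
    simp only [signFunction, ← Finset.mul_prod_erase _ _ (Finset.mem_univ i), hprod]
  · rw [hrect _ le_rfl, digitSign_flipDigit_self i hr]
    ring
  · rw [hrect _ hl.le, digitSign_flipDigit_of_lt i hl]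

theorem abs_digitSign {L : ℕ} (b : Fin L → Bool) (k : ℕ) : |digitSign b k| = 1 := by
  unfold digitSign
  split_ifs <;> simp

theorem abs_signFunction {α : DyadicRect d → ℝ}
    (hα : ∀ R ∈ hyperbolicRects d n, α R = 1 ∨ α R = -1) {r : Fin d → ℕ} (hr : ∑ i, r i = n)
    {L : ℕ} (ω : Fin d → Fin L → Bool) : |signFunction α r ω| = 1 := by
  rw [signFunction, abs_mul, Finset.abs_prod]
  simp only [abs_digitSign, Finset.prod_const_one, mul_one]
  rcases hα _ (digitRect_mem hr ω) with h | h <;> simp [h]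

end Rects

/-! ### Essential supremum, elimination of one level, and conclusion. -/

theorem ofReal_le_eLpNorm_top {X : Type*} [MeasurableSpace X] {μ : Measure X} {g : X → ℝ} {K : ℝ}
    {s : Set X} (hs : μ s ≠ 0) (h : ∀ x ∈ s, K ≤ |g x|) : ENNReal.ofReal K ≤ eLpNorm g ∞ μ := by
  by_contra! hcon
  have h1 := enorm_ae_le_eLpNormEssSup g μ
  rw [← eLpNorm_exponent_top] at h1
  refine hs (measure_mono_null (fun x hx => ?_) (ae_iff.1 h1))
  show ¬ ‖g x‖ₑ ≤ _
  rw [not_le]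
  refine hcon.trans_le ?_
  rw [Real.enorm_eq_ofReal_abs]
  exact ENNReal.ofReal_le_ofReal (h x hx)

theorem volume_restrict_digitCube_ne_zero {d L : ℕ} (ω : Fin d → Fin L → Bool) :
    volume.restrict (Set.Icc (0 : Fin d → ℝ) 1) (digitCube ω) ≠ 0 := by
  have hp : (0 : ℝ) < 2 ^ L := by positivity
  have hsub : digitCube ω ⊆ Set.Icc (0 : Fin d → ℝ) 1 := by
    intro x hx
    have h : ∀ i, 0 ≤ x i ∧ x i ≤ 1 := fun i => by
      obtain ⟨h1, h2⟩ := hx i (Set.mem_univ i)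
      have h3 : (digitPrefix (ω i) L : ℝ) + 1 ≤ 2 ^ L := by
        exact_mod_cast digitPrefix_lt (ω i) L
      exact ⟨le_trans (by positivity) h1, h2.le.trans ((div_le_one hp).2 h3)⟩
    exact ⟨fun i => (h i).1, fun i => (h i).2⟩
  rw [Measure.restrict_eq_self _ hsub, digitCube, volume_pi_pi, Finset.prod_ne_zero_iff]
  intro i _
  rw [digitInterval, Real.volume_Ico, ← sub_div]
  simp

/-- The vector with entries `m`, `ρ` of sum `n`, the second entry being determined by the others. -/
def levelVector {e n : ℕ} (m : Fin (n + 1)) (ρ : Fin e → Fin (n + 1)) : Fin (e + 2) → ℕ :=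
  Fin.cons (m : ℕ) (Fin.cons (n - (m + ∑ i, (ρ i : ℕ))) fun i => (ρ i : ℕ))

theorem sum_levelVector {e n : ℕ} {m : Fin (n + 1)} {ρ : Fin e → Fin (n + 1)}
    (h : (m : ℕ) + ∑ i, (ρ i : ℕ) ≤ n) : ∑ i, levelVector m ρ i = n := by
  rw [levelVector, Fin.sum_univ_succ, Fin.sum_univ_succ]
  simp only [Fin.cons_zero, Fin.cons_succ]
  omega

theorem levelVector_one {e n : ℕ} (m : Fin (n + 1)) (ρ : Fin e → Fin (n + 1)) :
    levelVector m ρ 1 = n - (m + ∑ i, (ρ i : ℕ)) := rfl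

theorem sum_piAntidiag_eq_sum_levels {e n : ℕ} (g : (Fin (e + 2) → ℕ) → ℝ) :
    ∑ r ∈ Finset.piAntidiag (Finset.univ : Finset (Fin (e + 2))) n, g r =
      ∑ m : Fin (n + 1), ∑ ρ : Fin e → Fin (n + 1),
        if (m : ℕ) + ∑ i, (ρ i : ℕ) ≤ n then
          g (levelVector m ρ) else 0 := by
  rw [← Fintype.sum_prod_type', ← Finset.sum_filter]
  symm
  refine Finset.sum_bij (fun q _ => levelVector q.1 q.2) ?_ ?_ ?_ fun _ _ => rfl
  · intro q hq
    exact Finset.mem_piAntidiag.2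
      ⟨sum_levelVector (Finset.mem_filter.1 hq).2, fun i _ => Finset.mem_univ i⟩
  · rintro ⟨a, b⟩ _ ⟨a', b'⟩ _ h
    have h1 := Fin.cons_injective2 h
    have h2 := Fin.cons_injective2 h1.2
    exact Prod.ext (Fin.ext h1.1) (funext fun i => Fin.ext (congrFun h2.2 i))
  · intro r hr
    have hsum := (Finset.mem_piAntidiag.1 hr).1
    have hle : ∀ i, r i < n + 1 := fun i => by
      have h2 : r i ≤ ∑ i, r i :=
        Finset.single_le_sum (fun _ _ => Nat.zero_le _) (Finset.mem_univ i)
      exact Nat.lt_succ_of_le (h2.trans hsum.le)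
    rw [Fin.sum_univ_succ, Fin.sum_univ_succ] at hsum
    refine ⟨(⟨r 0, hle 0⟩, fun i => ⟨r i.succ.succ, hle _⟩), ?_, ?_⟩
    · simp only [Finset.mem_filter, Finset.mem_univ, true_and]
      omega
    · ext i
      refine Fin.cases rfl (fun i => ?_) i
      refine Fin.cases ?_ (fun i => rfl) i
      simp only [levelVector, Fin.cons_succ, Fin.cons_zero]
      omega

/-- The functions `∑ α(R) h_R` over the rectangles of given side lengths form a Haar family. -/
theorem isHaarFamily_signFunction {e n : ℕ} {α : DyadicRect (e + 2) → ℝ}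
    (hα : ∀ R ∈ hyperbolicRects (e + 2) n, α R = 1 ∨ α R = -1) :
    IsHaarFamily n (flipDigit (n + 1) (1 : Fin (e + 2)))
      (fun i => flipDigit (n + 1) (i.succ.succ : Fin (e + 2))) (fun m : Fin (n + 1) => (m : ℕ))
      (fun m ρ ω => if (m : ℕ) + ∑ i, (ρ i : ℕ) ≤ n then
        signFunction α (levelVector m ρ) ω else 0) where
  haar m ρ i := by
    split_ifs with h
    · exact isHaar_signFunction α (r := levelVector m ρ) i.succ.succ (ρ i).isLt
    · exact IsHaar.zero
  haar_last m ρ v hv := by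
    have hle : (m : ℕ) + ∑ i, (ρ i : ℕ) ≤ n := by omega
    have h1 : levelVector m ρ 1 = v := by rw [levelVector_one]; omega
    have h := isHaar_signFunction α (r := levelVector m ρ) (L := n + 1) 1 (by omega)
    rw [h1] at h
    simpa only [hle, if_true] using h
  eq_zero m ρ h := by
    ext ω
    rw [if_neg (by omega)]
    rfl
  abs_le_one m ρ ω := by
    split_ifs with h
    · exact (abs_signFunction hα (sum_levelVector h) ω).le
    · simp

theorem mainTheorem1 (d : ℕ) (hd : 3 ≤ d) (η : ℝ)
    (hη : η < ((d : ℝ) - 1) / 2 + 1 / (8 * (d : ℝ))) :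
    ∃ c : ℝ, 0 < c ∧ ∀ n : ℕ, 1 ≤ n → ∀ α : DyadicRect d → ℝ,
      (∀ R ∈ hyperbolicRects d n, α R = 1 ∨ α R = -1) →
      ENNReal.ofReal (c * (n : ℝ) ^ η) ≤
        eLpNorm (hyperbolicHaarSum d n α) ∞
          (volume.restrict (Set.Icc (0 : Fin d → ℝ) 1)) := by
  obtain ⟨e, rfl⟩ : ∃ e, d = e + 2 := ⟨d - 2, by omega⟩
  obtain ⟨c, hc, hmain⟩ := exists_const_le_abs_sum (show 1 ≤ e by omega)
  refine ⟨c, hc, fun n hn α hα => ?_⟩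
  -- Coordinate `0` carries the outer martingale, coordinate `1` the forced level, and the remaining
  -- `e` are free.
  obtain ⟨ω, hω⟩ := hmain (τ₀ := flipDigit (n + 1) (0 : Fin (e + 2)))
    (isHaarFamily_signFunction hα)
    (fun m ρ => by
      split_ifs with h
      · exact isHaar_signFunction α (r := levelVector m ρ) 0 m.isLt
      · exact IsHaar.zero)
    (fun m ρ h ω => by
      rw [if_pos h, ← sq_abs, abs_signFunction hα (sum_levelVector h) ω, one_pow])
  have hn1 : (1 : ℝ) ≤ n := by exact_mod_cast hn
  -- One good digit string is enough: the sum is constant on its cube, which has positive measure.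
  refine ofReal_le_eLpNorm_top (volume_restrict_digitCube_ne_zero ω) fun x hx => ?_
  rw [hyperbolicHaarSum_eq_sum_signFunction α hx, sum_piAntidiag_eq_sum_levels]
  refine le_trans ?_ hω
  refine mul_le_mul_of_nonneg_left ?_ hc.le
  have hη' : η ≤ ((e : ℝ) + 1) / 2 + 1 / (8 * (e + 2)) := by
    push_cast at hη
    refine hη.le.trans_eq ?_
    ring
  calc (n : ℝ) ^ η ≤ (n : ℝ) ^ (((e : ℝ) + 1) / 2 + 1 / (8 * (e + 2))) :=
        Real.rpow_le_rpow_of_exponent_le hn1 hη'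
    _ ≤ _ := Real.rpow_le_rpow (by positivity) (by linarith) (by positivity)
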